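/- For a real number $b\ge 1$ and $\mathrm{Re}\,z>0$ let $f_b(z)=\sum_{k=0}^{\infty}e^{-zk^{b}}$, and for $d>0$, $s\in\mathbb{R}$ let $$Q_{b,d}(s)=\lim_{x\to 0^+}x^{1/d}f_b(x+2\pi i s)$$ whenever this limit exists. For $m,n,b\in\mathbb{N}$, $n\ge 1$, put $L_b(m,n)=\frac1n\sum_{l=1}^{n}e^{-2\pi i\frac mn l^{b}}$. (i) Let $b\ge 1$ be an integer. There is $M<\infty$ such that, for all sufficiently small $x>0$ and all $y\in\mathbb{R}$, $x^{1/b}|f_b(x+iy)|<M$. If $m,n\in\mathbb{N}$, $n\ge1$, are relatively prime, then $Q_{b,b}(m/n)$ exists and $$\frac{Q_{b,b}(m/n)}{\Gamma(1+1/b)}=L_b(m,n),$$ while $Q_{b,b}(s)$ exists and equals $0$ for almost every $s\in\mathbb{R}$. (ii) Let $b=3/2$. As $z\to0$ along the positive reals, $z^{2/3}f_{3/2}(z)\to\Gamma(5/3)$. For every real $y\ne0$, $f_{3/2}(x+iy)=O(x^{-1/2})$ as $x\to0^+$. If $m,n\ge1$ are relatively prime integers and $s=\frac{4}{27}\frac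 nm$, then $Q_{3/2,2}(\sqrt s)$ exists and $$Q_{3/2,2}(\sqrt s)=\sqrt{\frac{\pi}{3i}}\;s^{1/4}\,L_3(m,n),$$ while $Q_{3/2,2}(\sqrt s)$ exists and equals $0$ for almost every $s>0$. Moreover, for every real $s\ne0$, $Q_{3/2,2}(s)$ exists if and only if $Q_{3,3}\!\left(\frac{4}{27s^{2}}\right)$ exists, and in that case $$Q_{3/2,2}(s)=\frac{1}{\Gamma(4/3)}\sqrt{\frac{\pi s}{3i}}\;Q_{3,3}\!\left(\frac{4}{27s^{2}}\right).$$ Square roots are principal branches. -/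

import Mathlib

open Filter Topology MeasureTheory Asymptotics

/-- The Dirichlet series `f(z) = ∑_{k ≥ 0} exp (-z g(k))`. -/
noncomputable def dirichletSeries (g : ℕ → ℝ) (z : ℂ) : ℂ :=
  ∑' k : ℕ, Complex.exp (-z * (g k : ℂ))

/-- The function `f` attached to `g(k) = k ^ b`. -/
noncomputable def powerDirichlet (b : ℝ) (z : ℂ) : ℂ :=
  dirichletSeries (fun k => (k : ℝ) ^ b) z

/-- The series defining `powerDirichlet` converges absolutely in the right half plane. -/
theorem powerDirichlet_summable (b : ℝ) (hb : 1 ≤ b) (z : ℂ) (hz : 0 < z.re) :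
    Summable (fun k : ℕ => ‖Complex.exp (-z * (((k : ℝ) ^ b : ℝ) : ℂ))‖) := by
  have hgeo : Summable (fun k : ℕ => Real.exp (-z.re) ^ k) :=
    summable_geometric_of_lt_one (Real.exp_pos _).le (by simpa using hz)
  refine Summable.of_nonneg_of_le (fun k => norm_nonneg _) (fun k => ?_) hgeo
  rw [Complex.norm_exp, Complex.re_mul_ofReal, ← Real.exp_nat_mul]
  apply Real.exp_le_exp.mpr
  have hk : (k : ℝ) ≤ (k : ℝ) ^ b := by
    rcases Nat.eq_zero_or_pos k with h | h
    · subst h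
      simpa using Real.rpow_nonneg (le_refl (0 : ℝ)) b
    · have h1 : (1 : ℝ) ≤ (k : ℝ) := by exact_mod_cast h
      simpa using Real.rpow_le_rpow_of_exponent_le h1 hb
  simp only [Complex.neg_re]
  nlinarith

/-- `HasProfile b d s L` : the limit defining the rescaled boundary profile
`Q_{b,d}(s) = lim_{x → 0⁺} x ^ (1 / d) * f(x + 2 π i s)`, for `g(k) = k ^ b`, exists and
equals `L`. -/
def HasProfile (b d s : ℝ) (L : ℂ) : Prop :=
  Tendsto
    (fun x : ℝ => ((x ^ (1 / d) : ℝ) : ℂ) *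
      powerDirichlet b ((x : ℂ) + 2 * (Real.pi : ℂ) * Complex.I * (s : ℂ)))
    (𝓝[>] 0) (𝓝 L)

/-- The normalized exponential sum `(1 / n) ∑_{l = 1}^{n} exp (-2 π i (m / n) l ^ b)`. -/
noncomputable def expMean (b m n : ℕ) : ℂ :=
  (1 / (n : ℂ)) * ∑ l ∈ Finset.Icc 1 n,
    Complex.exp (-2 * (Real.pi : ℂ) * Complex.I * ((m : ℂ) / (n : ℂ)) * (l : ℂ) ^ b)

open Finset
open scoped Real FourierTransform RealInnerProductSpace ComplexConjugate

/-!
If the exponential sums `∑_{k < N} exp (-2πi s k ^ b)` are asymptotic to `C N ^ α`, an Abelian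
theorem for the weights `exp (-x k ^ b)` turns this into
`f_b(x + 2πi s) ∼ C Γ(1 + α / b) x ^ (-α / b)` as `x → 0⁺`. For integral `b` the sums have `α = 1`
and `C` is the mean of `k ↦ exp (-2πi s k ^ b)`: a normalized sum over one period if `s` is
rational and, by Weyl's theorem, zero if `s` is irrational.

For `b = 3 / 2` we have `α = 3 / 4`. The derivative of the phase `s k ^ (3 / 2)` passes through the
integer `j` at `k = (2 j / (3 s)) ^ 2`; the sum over a window around this point is close to a
Fresnel integral, and equals a constant times `√j exp (2πi t j ^ 3)`, `t = 4 / (27 s ^ 2)`, up to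
`o(√j)`. Between the windows the Kusmin–Landau inequality makes the sum negligible. So the profile
of `k ^ (3 / 2)` at `s` is governed by the mean of the cubic sequence `j ↦ exp (2πi t j ^ 3)`, that
is, by the profile of `k ^ 3` at `t`. This mean exists for every `t` and is real, since `j ↦ -j`
permutes the residues modulo the denominator of `t`, so that the sign of the phase does not matter.
-/

section Mean

variable {E F : Type*} [NormedAddCommGroup E] [NormedSpace ℝ E]
  [NormedAddCommGroup F] [NormedSpace ℝ F]

/-- The sequence `a` has mean `c`: its averages `(1 / N) ∑_{k < N} a k` converge to `c`. At `N = 0`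
the average is `0`. -/
def HasMean (a : ℕ → E) (c : E) : Prop :=
  Tendsto (fun N : ℕ => (N : ℝ)⁻¹ • ∑ k ∈ range N, a k) atTop (𝓝 c)

namespace HasMean

variable {a b : ℕ → E} {c d : E} {C : ℝ}

theorem congr (ha : HasMean a c) (h : ∀ k, a k = b k) : HasMean b c :=
  funext h ▸ ha

theorem add (ha : HasMean a c) (hb : HasMean b d) : HasMean (fun k => a k + b k) (c + d) :=
  (Tendsto.add ha hb).congr fun N => by rw [← smul_add, sum_add_distrib]

theorem sum {ι : Type*} (s : Finset ι) {a : ι → ℕ → E} {c : ι → E}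
    (h : ∀ i ∈ s, HasMean (a i) (c i)) :
    HasMean (fun k => ∑ i ∈ s, a i k) (∑ i ∈ s, c i) :=
  (tendsto_finsetSum s h).congr fun N => by rw [sum_comm, smul_sum]

theorem map (L : E →L[ℝ] F) (ha : HasMean a c) : HasMean (fun k => L (a k)) (L c) :=
  ((L.continuous.tendsto c).comp ha).congr fun N => by simp

theorem const (c : E) : HasMean (fun _ => c) c :=
  tendsto_const_nhds.cesaro_smul

theorem zero_of_norm_sum_le (h : ∀ N, ‖∑ k ∈ range N, a k‖ ≤ C) : HasMean a 0 := by
  refine squeeze_zero_norm (fun N => ?_) (tendsto_const_div_atTop_nhds_zero_nat C)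
  rw [norm_smul, norm_inv, RCLike.norm_natCast, inv_mul_eq_div]
  gcongr
  exact h N

theorem of_sub {c : E} (h : HasMean (fun k => a k - c) 0) : HasMean a c := by
  simpa using h.add (const c)

theorem translate_sub (hC : ∀ k, ‖a k‖ ≤ C) (m : ℕ) : HasMean (fun k => a (k + m) - a k) 0 := by
  refine zero_of_norm_sum_le (C := m * C + m * C) fun N => ?_
  have hsum : ∑ k ∈ range N, (a (k + m) - a k)
      = ∑ k ∈ range m, a (N + k) - ∑ k ∈ range m, a k := by
    have h := (sum_range_add a m N).symm.trans (add_comm m N ▸ sum_range_add a N m)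
    simp only [add_comm m] at h
    rw [sum_sub_distrib, sub_eq_sub_iff_add_eq_add, add_comm, h, add_comm]
  have hshort (M : ℕ) : ‖∑ k ∈ range m, a (M + k)‖ ≤ m * C := by
    simpa using norm_sum_le_of_le (range m) fun k _ => hC (M + k)
  rw [hsum]
  exact (norm_sub_le _ _).trans (add_le_add (hshort N) (by simpa using hshort 0))

theorem translate (hC : ∀ k, ‖a k‖ ≤ C) (ha : HasMean a c) (m : ℕ) :
    HasMean (fun k => a (k + m)) c := by
  simpa using ha.add (translate_sub hC m)

theorem of_periodic {n : ℕ} (hn : 0 < n) (h : Function.Periodic a n) :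
    HasMean a ((n : ℝ)⁻¹ • ∑ k ∈ range n, a k) := by
  set c := (n : ℝ)⁻¹ • ∑ k ∈ range n, a k with hc
  let S : ℕ → E := fun N => ∑ k ∈ range N, (a k - c)
  have hSn : S n = 0 := by
    simp only [S, sum_sub_distrib, sum_const, card_range, hc, ← Nat.cast_smul_eq_nsmul ℝ]
    rw [smul_inv_smul₀ (by positivity), sub_self]
  have hS : Function.Periodic S n := fun N => by
    have hadd : S (n + N) = S n + ∑ k ∈ range N, (a (n + k) - c) := sum_range_add _ n N
    rw [add_comm, hadd, hSn, zero_add]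
    exact sum_congr rfl fun k _ => by rw [add_comm, h k]
  refine of_sub (zero_of_norm_sum_le (C := ∑ r ∈ range n, ‖S r‖) fun N => ?_)
  calc ‖S N‖ = ‖S (N % n)‖ := by rw [hS.map_mod_nat]
    _ ≤ ∑ r ∈ range n, ‖S r‖ :=
      single_le_sum (f := fun r => ‖S r‖) (fun _ _ => norm_nonneg _)
        (mem_range.mpr (Nat.mod_lt N hn))

end HasMean

theorem norm_smul_sum_sq_le (v : ℕ → E) (N : ℕ) :
    ‖(N : ℝ)⁻¹ • ∑ n ∈ range N, v n‖ ^ 2 ≤ (N : ℝ)⁻¹ * ∑ n ∈ range N, ‖v n‖ ^ 2 := by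
  have hsq : ‖∑ n ∈ range N, v n‖ ^ 2 ≤ N * ∑ n ∈ range N, ‖v n‖ ^ 2 := by
    have h := sq_sum_le_card_mul_sum_sq (s := range N) (f := fun n => ‖v n‖)
    rw [card_range] at h
    exact (pow_le_pow_left₀ (norm_nonneg _) (norm_sum_le _ _) 2).trans h
  rcases N.eq_zero_or_pos with rfl | hN
  · simp
  calc ‖(N : ℝ)⁻¹ • ∑ n ∈ range N, v n‖ ^ 2
      = ((N : ℝ)⁻¹) ^ 2 * ‖∑ n ∈ range N, v n‖ ^ 2 := by
        rw [norm_smul, mul_pow, norm_inv, RCLike.norm_natCast]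
    _ ≤ ((N : ℝ)⁻¹) ^ 2 * (N * ∑ n ∈ range N, ‖v n‖ ^ 2) := by gcongr
    _ = (N : ℝ)⁻¹ * ∑ n ∈ range N, ‖v n‖ ^ 2 := by field_simp

end Mean

section VanDerCorput

variable {E : Type*} [NormedAddCommGroup E] [InnerProductSpace ℝ E] {u : ℕ → E} {C : ℝ}

namespace HasMean

theorem inner_translate (hu : ∀ n, ‖u n‖ ≤ C)
    (hc : ∀ h : ℕ, 1 ≤ h → HasMean (fun n => ⟪u (n + h), u n⟫) 0) {i j : ℕ} (hij : i ≠ j) :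
    HasMean (fun n => ⟪u (n + i), u (n + j)⟫) 0 := by
  wlog hji : j < i generalizing i j
  · simpa only [real_inner_comm] using this hij.symm (by omega)
  have hbound (n : ℕ) : ‖⟪u (n + (i - j)), u n⟫‖ ≤ C * C :=
    (norm_inner_le_norm _ _).trans
      (mul_le_mul (hu _) (hu _) (norm_nonneg _) ((norm_nonneg _).trans (hu 0)))
  have h := (hc (i - j) (by omega)).translate hbound j
  simpa only [add_assoc, Nat.add_sub_cancel' hji.le] using h

theorem norm_sq_sum_translate_sub_diagonal (hu : ∀ n, ‖u n‖ ≤ C)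
    (hc : ∀ h : ℕ, 1 ≤ h → HasMean (fun n => ⟪u (n + h), u n⟫) 0) (H : ℕ) :
    HasMean (fun n => ‖∑ i ∈ range H, u (n + i)‖ ^ 2 - ∑ i ∈ range H, ‖u (n + i)‖ ^ 2) 0 := by
  have hoff : HasMean (fun n => ∑ i ∈ range H, ∑ j ∈ (range H).erase i,
      ⟪u (n + i), u (n + j)⟫) (∑ i ∈ range H, ∑ _j ∈ (range H).erase i, (0 : ℝ)) :=
    sum _ fun i _ => sum _ fun j hj => inner_translate hu hc (ne_of_mem_erase hj).symm
  simp only [sum_const_zero] at hoff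
  refine hoff.congr fun n => ?_
  rw [← real_inner_self_eq_norm_sq, sum_inner, eq_sub_iff_add_eq, ← sum_add_distrib]
  refine sum_congr rfl fun i hi => ?_
  rw [inner_sum, ← add_sum_erase _ _ hi, real_inner_self_eq_norm_sq, add_comm]

theorem eventually_norm_smul_sum_translates_sq_le (hu : ∀ n, ‖u n‖ ≤ C)
    (hc : ∀ h : ℕ, 1 ≤ h → HasMean (fun n => ⟪u (n + h), u n⟫) 0) (H : ℕ) :
    ∀ᶠ N : ℕ in atTop,
      ‖(N : ℝ)⁻¹ • ∑ n ∈ range N, ∑ i ∈ range H, u (n + i)‖ ^ 2 ≤ H * C ^ 2 + 1 := by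
  have hoff := (norm_sq_sum_translate_sub_diagonal hu hc H).eventually (ge_mem_nhds one_pos)
  filter_upwards [hoff] with N hN
  have hdiag : (N : ℝ)⁻¹ * ∑ n ∈ range N, ∑ i ∈ range H, ‖u (n + i)‖ ^ 2 ≤ H * C ^ 2 := by
    have hle : ∑ n ∈ range N, ∑ i ∈ range H, ‖u (n + i)‖ ^ 2 ≤ N * (H * C ^ 2) := by
      calc ∑ n ∈ range N, ∑ i ∈ range H, ‖u (n + i)‖ ^ 2
          ≤ ∑ n ∈ range N, ∑ i ∈ range H, C ^ 2 := by gcongr; exact hu _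
        _ = N * (H * C ^ 2) := by simp
    have hHC : 0 ≤ H * C ^ 2 := by positivity
    exact inv_mul_le_of_le_mul₀ N.cast_nonneg hHC hle
  rw [smul_eq_mul, sum_sub_distrib, mul_sub] at hN
  exact (norm_smul_sum_sq_le _ N).trans (by linarith)

theorem zero_of_inner_translate (hu : ∀ n, ‖u n‖ ≤ C)
    (hc : ∀ h : ℕ, 1 ≤ h → HasMean (fun n => ⟪u (n + h), u n⟫) 0) : HasMean u 0 := by
  have hC : 0 ≤ C := (norm_nonneg _).trans (hu 0)
  rw [HasMean, tendsto_zero_iff_norm_tendsto_zero, Metric.tendsto_nhds]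
  intro ε hε
  obtain ⟨H, hH⟩ := exists_nat_gt (max 1 (((C + 2) / ε) ^ 2))
  have hH1 : (1 : ℝ) < H := (le_max_left _ _).trans_lt hH
  have hHε : C + 2 < ε * √H := by
    rw [← div_lt_iff₀' hε]
    exact Real.lt_sqrt_of_sq_lt ((le_max_right _ _).trans_lt hH)
  have htranslates : HasMean (fun n => ∑ i ∈ range H, (u (n + i) - u n)) 0 := by
    simpa using sum (range H) fun i _ => translate_sub hu i
  filter_upwards [eventually_norm_smul_sum_translates_sq_le hu hc H,
    htranslates.norm.eventually (ge_mem_nhds (by simp : ‖(0 : E)‖ < 1))] with N hN hN'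
  set T := (N : ℝ)⁻¹ • ∑ n ∈ range N, ∑ i ∈ range H, u (n + i) with hT
  set A := (N : ℝ)⁻¹ • ∑ n ∈ range N, u n with hA
  have hsplit : (H : ℝ) • A = T - (N : ℝ)⁻¹ • ∑ n ∈ range N, ∑ i ∈ range H, (u (n + i) - u n) := by
    simp only [hT, hA, sum_sub_distrib, sum_const, card_range, smul_sub, ← smul_sum,
      ← Nat.cast_smul_eq_nsmul ℝ]
    rw [sub_sub_cancel, smul_comm]
  have hTle : ‖T‖ ≤ C * √H + 1 := by
    refine abs_le_of_sq_le_sq' (hN.trans ?_) (by positivity) |>.2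
    nlinarith [Real.sq_sqrt (zero_le_one.trans hH1.le), mul_nonneg hC (Real.sqrt_nonneg (H : ℝ))]
  have hsqrt : 1 ≤ √(H : ℝ) := Real.one_le_sqrt.mpr hH1.le
  have hHA : √H * (√H * ‖A‖) < √H * (√H * ε) :=
    calc √H * (√H * ‖A‖) = ‖(H : ℝ) • A‖ := by
          rw [← mul_assoc, Real.mul_self_sqrt H.cast_nonneg, norm_smul (H : ℝ), RCLike.norm_natCast]
      _ ≤ ‖T‖ + 1 := by rw [hsplit]; exact (norm_sub_le _ _).trans (by gcongr)
      _ ≤ √H * (C + 2) := by linarith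
      _ < √H * (√H * ε) := by rw [mul_comm √H ε]; gcongr
  rw [Real.dist_eq, sub_zero, abs_of_nonneg (norm_nonneg _)]
  exact lt_of_mul_lt_mul_left (lt_of_mul_lt_mul_left hHA (by positivity)) (by positivity)

end HasMean

end VanDerCorput

section Weyl

theorem fourierChar_eq_one_iff {x : ℝ} : 𝐞 x = 1 ↔ ∃ n : ℤ, x = n := by
  rw [Real.fourierChar_apply', Circle.exp_eq_one]
  refine exists_congr fun n => ?_
  rw [mul_comm, mul_left_inj' Real.two_pi_pos.ne']

theorem inner_fourierChar (x y : ℝ) : ⟪(𝐞 x : ℂ), (𝐞 y : ℂ)⟫ = (𝐞 (x - y) : ℂ).re := by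
  rw [real_inner_comm, Complex.inner, sub_eq_add_neg, AddChar.map_add_eq_mul,
    AddChar.map_neg_eq_inv, Circle.coe_mul, Circle.coe_inv_eq_conj]

theorem HasMean.conj {a : ℕ → ℂ} {c : ℂ} (ha : HasMean a c) :
    HasMean (fun k => conj (a k)) (conj c) :=
  ha.map Complex.conjCLE.toContinuousLinearMap

theorem HasMean.re {a : ℕ → ℂ} {c : ℂ} (ha : HasMean a c) : HasMean (fun k => (a k).re) c.re :=
  ha.map Complex.reCLM

theorem HasMean.const_mul {a : ℕ → ℂ} {c : ℂ} (z : ℂ) (ha : HasMean a c) :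
    HasMean (fun k => z * a k) (z * c) :=
  ha.map ((ContinuousLinearMap.mul ℂ ℂ z).restrictScalars ℝ)

theorem hasMean_pow_of_norm_eq_one {z : ℂ} (hz : ‖z‖ = 1) (hz1 : z ≠ 1) :
    HasMean (fun n => z ^ n) 0 := by
  refine HasMean.zero_of_norm_sum_le (C := 2 / ‖z - 1‖) fun N => ?_
  rw [geom_sum_eq hz1, norm_div]
  gcongr
  simpa [hz, one_add_one_eq_two] using norm_sub_le (z ^ N) 1

theorem eval_hasseDeriv_of_natDegree_le {R : Type*} [CommSemiring R] {p : Polynomial R} {k : ℕ}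
    (hp : p.natDegree ≤ k + 1) (r : R) :
    (Polynomial.hasseDeriv k p).eval r = p.coeff k + (k + 1) * p.coeff (k + 1) * r := by
  have hdeg : (Polynomial.hasseDeriv k p).natDegree ≤ 1 :=
    (Polynomial.natDegree_hasseDeriv_le p k).trans (by omega)
  rw [Polynomial.eq_X_add_C_of_natDegree_le_one hdeg]
  simp only [Polynomial.eval_add, Polynomial.eval_mul, Polynomial.eval_C, Polynomial.eval_X,
    Polynomial.hasseDeriv_coeff, zero_add, Nat.choose_self, add_comm 1 k,
    Nat.choose_succ_self_right]
  push_cast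
  ring

theorem coeff_taylor_sub_self {R : Type*} [CommRing R] {p : Polynomial R} {k : ℕ}
    (hp : p.natDegree ≤ k + 1) (r : R) :
    (Polynomial.taylor r p - p).coeff k = (k + 1) * p.coeff (k + 1) * r := by
  rw [Polynomial.coeff_sub, Polynomial.taylor_coeff, eval_hasseDeriv_of_natDegree_le hp]
  ring

theorem natDegree_taylor_sub_self_le {R : Type*} [CommRing R] {p : Polynomial R} {k : ℕ}
    (hp : p.natDegree ≤ k + 1) (r : R) : (Polynomial.taylor r p - p).natDegree ≤ k := by
  rw [Polynomial.natDegree_le_iff_coeff_eq_zero]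
  intro j hj
  rw [coeff_taylor_sub_self (hp.trans (by omega)), Polynomial.coeff_eq_zero_of_natDegree_lt
    (hp.trans_lt (by omega)), mul_zero, zero_mul]

theorem hasMean_fourierChar_eval {p : Polynomial ℝ} {d : ℕ} (hd : p.natDegree ≤ d + 1)
    (hp : Irrational (p.coeff (d + 1))) : HasMean (fun n => (𝐞 (p.eval (n : ℝ)) : ℂ)) 0 := by
  induction d generalizing p with
  | zero =>
    have hne : (𝐞 (p.coeff 1) : ℂ) ≠ 1 := by
      rw [Ne, Circle.coe_eq_one, fourierChar_eq_one_iff]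
      rintro ⟨n, hn⟩
      exact hp ⟨n, by simpa using hn.symm⟩
    have hlin := (hasMean_pow_of_norm_eq_one (Circle.norm_coe _) hne).const_mul (𝐞 (p.coeff 0))
    rw [mul_zero] at hlin
    refine hlin.congr fun n => ?_
    rw [Polynomial.eq_X_add_C_of_natDegree_le_one hd]
    simp [add_comm, AddChar.map_add_eq_mul, mul_comm (p.coeff 1), ← nsmul_eq_mul,
      AddChar.map_nsmul_eq_pow]
  | succ d ih =>
    refine HasMean.zero_of_inner_translate (fun n => (Circle.norm_coe _).le) fun h hh => ?_
    have hirr : Irrational ((Polynomial.taylor (h : ℝ) p - p).coeff (d + 1)) := by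
      have hcoeff : (Polynomial.taylor (h : ℝ) p - p).coeff (d + 1)
          = p.coeff (d + 1 + 1) * (((d + 1 + 1) * h : ℕ) : ℝ) := by
        rw [coeff_taylor_sub_self hd]
        push_cast
        ring
      rw [hcoeff]
      exact hp.mul_natCast (by positivity)
    refine (ih (natDegree_taylor_sub_self_le hd _) hirr).re.congr fun n => ?_
    rw [inner_fourierChar, Polynomial.eval_sub, Polynomial.taylor_eval, Nat.cast_add]

theorem hasMean_fourierChar_mul_pow {α : ℝ} (hα : Irrational α) {b : ℕ} (hb : 1 ≤ b) :
    HasMean (fun n => (𝐞 (α * (n : ℝ) ^ b) : ℂ)) 0 := by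
  obtain ⟨d, rfl⟩ := Nat.exists_eq_add_of_le' hb
  simpa using hasMean_fourierChar_eval (p := Polynomial.C α * Polynomial.X ^ (d + 1))
    (Polynomial.natDegree_C_mul_X_pow_le _ _) (by simpa using hα)

end Weyl

section Abelian

variable {E : Type*} [NormedAddCommGroup E] [NormedSpace ℝ E] {a : ℕ → E} {b α : ℝ} {C : E}

theorem integrableOn_exp_neg_smul_Ioi (v : E) (c : ℝ) :
    IntegrableOn (fun u : ℝ => Real.exp (-u) • v) (Set.Ioi c) :=
  (integrableOn_exp_neg_Ioi c).smul_const v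

theorem setIntegral_indicator_Ioi_exp_neg_smul [CompleteSpace E] {c : ℝ} (hc : 0 ≤ c) (v : E) :
    ∫ u in Set.Ioi (0 : ℝ), (Set.Ioi c).indicator (fun u => Real.exp (-u) • v) u
      = Real.exp (-c) • v := by
  rw [setIntegral_indicator measurableSet_Ioi, Set.inter_eq_right.mpr (Set.Ioi_subset_Ioi hc),
    integral_smul_const, integral_exp_neg_Ioi]

theorem tsum_exp_neg_rpow_smul_eq_integral [CompleteSpace E] (hb : 0 < b) {y : ℝ} (hy : 0 < y)
    (ha : Summable fun k : ℕ => Real.exp (-(k / y) ^ b) * ‖a k‖) :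
    ∑' k : ℕ, Real.exp (-(k / y) ^ b) • a k
      = ∫ u in Set.Ioi (0 : ℝ), Real.exp (-u) • ∑ k ∈ range ⌈y * u ^ b⁻¹⌉₊, a k := by
  let F : ℕ → ℝ → E := fun k => (Set.Ioi ((k / y) ^ b)).indicator fun u => Real.exp (-u) • a k
  have hfreq (k : ℕ) : 0 ≤ (k / y) ^ b := by positivity
  have hF (k : ℕ) : Integrable (F k) (volume.restrict (Set.Ioi 0)) :=
    ((integrableOn_exp_neg_smul_Ioi (a k) _).integrable_indicator measurableSet_Ioi).restrict
  have hnorm (k : ℕ) : ∫ u in Set.Ioi (0 : ℝ), ‖F k u‖ = Real.exp (-(k / y) ^ b) * ‖a k‖ := by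
    simpa only [F, norm_indicator_eq_indicator_norm, norm_smul, Real.norm_eq_abs, Real.abs_exp,
      smul_eq_mul] using setIntegral_indicator_Ioi_exp_neg_smul (hfreq k) ‖a k‖
  have hswap := integral_tsum_of_summable_integral_norm hF (by simpa only [hnorm] using ha)
  simp only [F, setIntegral_indicator_Ioi_exp_neg_smul (hfreq _)] at hswap
  rw [hswap]
  refine setIntegral_congr_fun measurableSet_Ioi fun u (hu : 0 < u) => ?_
  have hmem (k : ℕ) : u ∈ Set.Ioi ((k / y) ^ b) ↔ k ∈ range ⌈y * u ^ b⁻¹⌉₊ := by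
    rw [mem_range, Nat.lt_ceil, Set.mem_Ioi, ← div_lt_iff₀' hy,
      Real.lt_rpow_inv_iff_of_pos (by positivity) hu.le hb]
  rw [tsum_eq_sum fun k hk => Set.indicator_of_notMem (mt (hmem k).mp hk) _, smul_sum]
  exact sum_congr rfl fun k hk => Set.indicator_of_mem ((hmem k).mpr hk) _

theorem tendsto_inv_rpow_smul_comp_ceil {A : ℕ → E} (hα : 0 ≤ α)
    (hA : Tendsto (fun N : ℕ => ((N : ℝ) ^ α)⁻¹ • A N) atTop (𝓝 C)) {t : ℝ} (ht : 0 < t) :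
    Tendsto (fun y : ℝ => (y ^ α)⁻¹ • A ⌈y * t⌉₊) atTop (𝓝 (t ^ α • C)) := by
  have hceil : Tendsto (fun y : ℝ => ⌈y * t⌉₊) atTop atTop :=
    tendsto_nat_ceil_atTop.comp (tendsto_id.atTop_mul_const ht)
  have hratio : Tendsto (fun y : ℝ => ((⌈y * t⌉₊ : ℝ) / y) ^ α) atTop (𝓝 (t ^ α)) := by
    simpa only [mul_comm t] using (tendsto_nat_ceil_mul_div_atTop ht.le).rpow_const (Or.inr hα)
  refine (hratio.smul (hA.comp hceil)).congr' ?_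
  filter_upwards [eventually_gt_atTop 0] with y hy
  have hN : (0 : ℝ) < ⌈y * t⌉₊ := Nat.cast_pos.mpr (Nat.ceil_pos.mpr (by positivity))
  rw [Function.comp_apply, smul_smul, Real.div_rpow hN.le hy.le]
  congr 1
  field_simp

theorem exists_norm_sum_range_le_mul_rpow (hα : α ≠ 0)
    (h : Tendsto (fun N : ℕ => ((N : ℝ) ^ α)⁻¹ • ∑ k ∈ range N, a k) atTop (𝓝 C)) :
    ∃ M : ℝ, 0 ≤ M ∧ ∀ N : ℕ, ‖∑ k ∈ range N, a k‖ ≤ M * (N : ℝ) ^ α := by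
  obtain ⟨M, hM⟩ := (Metric.isBounded_range_of_tendsto _ h).exists_norm_le
  replace hM (N : ℕ) := hM _ ⟨N, rfl⟩
  refine ⟨M, (norm_nonneg _).trans (hM 0), fun N => ?_⟩
  rcases N.eq_zero_or_pos with rfl | hN
  · simp [Real.zero_rpow hα]
  have hpos : 0 < (N : ℝ) ^ α := by positivity
  have hMN := hM N
  rwa [norm_smul, norm_inv, Real.norm_of_nonneg hpos.le, inv_mul_le_iff₀' hpos] at hMN

theorem add_one_rpow_le {t : ℝ} (ht : 0 ≤ t) (hα : 0 ≤ α) :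
    (t + 1) ^ α ≤ 2 ^ α * (t ^ α + 1) := by
  calc (t + 1) ^ α ≤ (2 * max t 1) ^ α :=
        Real.rpow_le_rpow (by positivity) (by linarith [le_max_left t 1, le_max_right t 1]) hα
    _ = 2 ^ α * (max t 1) ^ α := Real.mul_rpow (by positivity) (by positivity)
    _ ≤ 2 ^ α * (t ^ α + 1) := by
        gcongr
        rcases max_choice t 1 with h | h <;> rw [h]
        · linarith
        · rw [Real.one_rpow]
          linarith [Real.rpow_nonneg ht α]

theorem norm_inv_rpow_smul_comp_ceil_le {A : ℕ → E} {M : ℝ} (hα : 0 ≤ α) (hM0 : 0 ≤ M)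
    (hM : ∀ N : ℕ, ‖A N‖ ≤ M * (N : ℝ) ^ α) {y t : ℝ} (hy : 1 ≤ y) (ht : 0 ≤ t) :
    ‖(y ^ α)⁻¹ • A ⌈y * t⌉₊‖ ≤ M * 2 ^ α * (t ^ α + 1) := by
  have hy0 : 0 < y := by linarith
  have hceil : (⌈y * t⌉₊ : ℝ) ≤ y * (t + 1) := by
    have := (Nat.ceil_lt_add_one (mul_nonneg hy0.le ht)).le
    linarith
  calc ‖(y ^ α)⁻¹ • A ⌈y * t⌉₊‖
      = (y ^ α)⁻¹ * ‖A ⌈y * t⌉₊‖ := by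
        rw [norm_smul, norm_inv, Real.norm_of_nonneg (by positivity)]
    _ ≤ (y ^ α)⁻¹ * (M * (y * (t + 1)) ^ α) := by
        gcongr
        exact (hM _).trans (by gcongr)
    _ = M * (t + 1) ^ α := by
        rw [Real.mul_rpow hy0.le (by positivity)]
        field_simp
    _ ≤ M * (2 ^ α * (t ^ α + 1)) := by
        gcongr
        exact add_one_rpow_le ht hα
    _ = M * 2 ^ α * (t ^ α + 1) := by ring

theorem tendsto_integral_exp_neg_smul_sum_ceil (hb : 0 < b) (hα : 0 < α)
    (h : Tendsto (fun N : ℕ => ((N : ℝ) ^ α)⁻¹ • ∑ k ∈ range N, a k) atTop (𝓝 C)) :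
    Tendsto (fun y : ℝ => ∫ u in Set.Ioi (0 : ℝ),
        Real.exp (-u) • (y ^ α)⁻¹ • ∑ k ∈ range ⌈y * u ^ b⁻¹⌉₊, a k) atTop
      (𝓝 (∫ u in Set.Ioi (0 : ℝ), Real.exp (-u) • (u ^ b⁻¹) ^ α • C)) := by
  obtain ⟨M, hM0, hM⟩ := exists_norm_sum_range_le_mul_rpow hα.ne' h
  refine tendsto_integral_filter_of_dominated_convergence
    (fun u => M * 2 ^ α * (Real.exp (-u) * u ^ ((α / b + 1) - 1) + Real.exp (-u)))
    (Eventually.of_forall fun y => ?_) ?_ ?_ ?_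
  · have hmeas : StronglyMeasurable fun u : ℝ => ∑ k ∈ range ⌈y * u ^ b⁻¹⌉₊, a k :=
      (StronglyMeasurable.of_discrete (f := fun N : ℕ => ∑ k ∈ range N, a k)).comp_measurable
        (Nat.measurable_ceil.comp (by fun_prop))
    exact ((by fun_prop : StronglyMeasurable fun u : ℝ => Real.exp (-u)).smul
      (hmeas.const_smul _)).aestronglyMeasurable
  · filter_upwards [eventually_ge_atTop 1] with y hy
    refine (ae_restrict_iff' measurableSet_Ioi).mpr (Eventually.of_forall fun u (hu : 0 < u) => ?_)
    rw [norm_smul, Real.norm_eq_abs, Real.abs_exp]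
    refine (mul_le_mul_of_nonneg_left (norm_inv_rpow_smul_comp_ceil_le hα.le hM0 hM hy
      (Real.rpow_nonneg hu.le _)) (Real.exp_pos _).le).trans_eq ?_
    rw [← Real.rpow_mul hu.le, inv_mul_eq_div, add_sub_cancel_right]
    ring
  · exact ((Real.GammaIntegral_convergent (by positivity)).add
      (integrableOn_exp_neg_Ioi 0)).const_mul _
  · refine (ae_restrict_iff' measurableSet_Ioi).mpr (Eventually.of_forall fun u (hu : 0 < u) => ?_)
    exact (tendsto_inv_rpow_smul_comp_ceil hα.le h (by positivity)).const_smul _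

theorem integral_exp_neg_smul_rpow_smul [CompleteSpace E] (h : 0 < 1 + α / b) (C : E) :
    ∫ u in Set.Ioi (0 : ℝ), Real.exp (-u) • (u ^ b⁻¹) ^ α • C
      = Real.Gamma (1 + α / b) • C := by
  rw [Real.Gamma_eq_integral h, ← integral_smul_const]
  refine setIntegral_congr_fun measurableSet_Ioi fun u (hu : 0 < u) => ?_
  rw [smul_smul, ← Real.rpow_mul hu.le, inv_mul_eq_div, add_sub_cancel_left]

theorem tendsto_rpow_smul_tsum_exp_neg [CompleteSpace E] (hb : 0 < b) (hα : 0 < α)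
    (ha : ∀ x : ℝ, 0 < x → Summable fun k : ℕ => Real.exp (-(x * (k : ℝ) ^ b)) * ‖a k‖)
    (h : Tendsto (fun N : ℕ => ((N : ℝ) ^ α)⁻¹ • ∑ k ∈ range N, a k) atTop (𝓝 C)) :
    Tendsto (fun x : ℝ => x ^ (α / b) • ∑' k : ℕ, Real.exp (-(x * (k : ℝ) ^ b)) • a k) (𝓝[>] 0)
      (𝓝 (Real.Gamma (1 + α / b) • C)) := by
  have hscale : Tendsto (fun x : ℝ => x⁻¹ ^ b⁻¹) (𝓝[>] 0) atTop :=
    (tendsto_rpow_atTop (by positivity)).comp tendsto_inv_nhdsGT_zero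
  rw [← integral_exp_neg_smul_rpow_smul (by positivity)]
  refine ((tendsto_integral_exp_neg_smul_sum_ceil hb hα h).comp hscale).congr' ?_
  filter_upwards [self_mem_nhdsWithin] with x (hx : 0 < x)
  have hfreq (k : ℕ) : (k / x⁻¹ ^ b⁻¹) ^ b = x * (k : ℝ) ^ b := by
    rw [Real.div_rpow k.cast_nonneg (by positivity), Real.rpow_inv_rpow (by positivity) hb.ne']
    field_simp
  have hnormalization : ((x⁻¹ ^ b⁻¹) ^ α)⁻¹ = x ^ (α / b) := by
    rw [← Real.rpow_mul (by positivity), Real.inv_rpow hx.le, inv_inv, inv_mul_eq_div]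
  have hLaplace := tsum_exp_neg_rpow_smul_eq_integral (a := a) hb (y := x⁻¹ ^ b⁻¹) (by positivity)
    (by simpa only [hfreq] using ha x hx)
  simp only [hfreq] at hLaplace
  rw [Function.comp_apply, hLaplace, hnormalization, ← integral_smul]
  simp only [smul_comm (Real.exp _)]

end Abelian

theorem two_mul_le_sin_pi_mul {δ x : ℝ} (hδ : 0 ≤ δ) (hx : x ∈ Set.Icc δ (1 - δ)) :
    2 * δ ≤ Real.sin (π * x) := by
  have jordan : ∀ y, δ ≤ y → y ≤ 1 / 2 → 2 * δ ≤ Real.sin (π * y) := fun y hy hy' => by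
    have h := Real.mul_le_sin (x := π * y) (by have := Real.pi_pos; nlinarith)
      (by nlinarith [Real.pi_pos])
    rw [show 2 / π * (π * y) = 2 * y by field_simp] at h
    linarith
  rcases le_total x (1 / 2) with h | h
  · exact jordan x hx.1 h
  · have := jordan (1 - x) (by linarith [hx.2]) (by linarith)
    rwa [show π * (1 - x) = π - π * x by ring, Real.sin_pi_sub] at this

theorem norm_one_sub_fourierChar (x : ℝ) : ‖1 - (𝐞 x : ℂ)‖ = 2 * |Real.sin (π * x)| := by
  rw [norm_sub_rev, Real.fourierChar_apply, mul_comm _ Complex.I,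
    Complex.norm_exp_I_mul_ofReal_sub_one, norm_mul, Real.norm_ofNat, Real.norm_eq_abs,
    show 2 * π * x / 2 = π * x by ring]

theorem inv_one_sub_fourierChar {x : ℝ} (hx : Real.sin (π * x) ≠ 0) :
    (1 - (𝐞 x : ℂ))⁻¹ = (1 + Complex.I * Real.cot (π * x)) / 2 := by
  have hne : 1 - (𝐞 x : ℂ) ≠ 0 := by
    rw [← norm_ne_zero_iff, norm_one_sub_fourierChar]
    simpa using hx
  have hexp : (𝐞 x : ℂ) = Complex.exp (2 * π * Complex.I * x) := by
    rw [Real.fourierChar_apply]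
    push_cast
    ring_nf
  rw [Complex.ofReal_cot, Complex.ofReal_mul, Complex.cot_pi_eq_exp_ratio, ← hexp]
  field_simp
  ring

theorem antitoneOn_cot : AntitoneOn Real.cot (Set.Ioo 0 π) := fun x hx y hy hxy => by
  have hsin := Real.sin_nonneg_of_nonneg_of_le_pi (sub_nonneg.mpr hxy) (by linarith [hx.1, hy.2])
  rw [Real.sin_sub] at hsin
  rw [Real.cot_eq_cos_div_sin, Real.cot_eq_cos_div_sin,
    div_le_div_iff₀ (Real.sin_pos_of_mem_Ioo hy) (Real.sin_pos_of_mem_Ioo hx)]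
  linarith

theorem sum_range_eq_of_mul_sub_succ {R : Type*} [CommRing R] {z c : ℕ → R} {n : ℕ}
    (h : ∀ k ≤ n, c k * (z k - z (k + 1)) = z k) :
    ∑ k ∈ range (n + 2), z k =
      c 0 * z 0 + ∑ k ∈ range n, (c (k + 1) - c k) * z (k + 1) + (1 - c n) * z (n + 1) := by
  induction n with
  | zero =>
    simp only [sum_range_succ, range_zero, sum_empty]
    linear_combination -h 0 le_rfl
  | succ n ih =>
    rw [sum_range_succ, ih fun k hk => h k (hk.trans n.le_succ), sum_range_succ _ n]
    linear_combination -h (n + 1) le_rfl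

section KusminLandau

variable {δ x y : ℝ}

theorem norm_inv_one_sub_fourierChar_le (hδ : 0 < δ) (hx : x ∈ Set.Icc δ (1 - δ)) :
    ‖(1 - (𝐞 x : ℂ))⁻¹‖ ≤ 1 / (4 * δ) := by
  rw [norm_inv, ← one_div, norm_one_sub_fourierChar]
  refine one_div_le_one_div_of_le (by positivity) ?_
  linarith [two_mul_le_sin_pi_mul hδ.le hx, le_abs_self (Real.sin (π * x))]

theorem fourierChar_ne_one_of_mem_Icc (hδ : 0 < δ) (hx : x ∈ Set.Icc δ (1 - δ)) :
    (𝐞 x : ℂ) ≠ 1 := by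
  intro h
  have hnorm := norm_one_sub_fourierChar x
  rw [h, sub_self, norm_zero] at hnorm
  linarith [two_mul_le_sin_pi_mul hδ.le hx, le_abs_self (Real.sin (π * x))]

theorem abs_cot_pi_mul_le (hδ : 0 < δ) (hx : x ∈ Set.Icc δ (1 - δ)) :
    |Real.cot (π * x)| ≤ 1 / (2 * δ) := by
  have hsin := two_mul_le_sin_pi_mul hδ.le hx
  rw [Real.cot_eq_cos_div_sin, abs_div]
  exact div_le_div₀ zero_le_one (Real.abs_cos_le_one _) (by positivity)
    (hsin.trans (le_abs_self _))

theorem norm_one_sub_inv_one_sub_fourierChar (hx : (𝐞 x : ℂ) ≠ 1) :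
    ‖1 - (1 - (𝐞 x : ℂ))⁻¹‖ = ‖(1 - (𝐞 x : ℂ))⁻¹‖ := by
  have h : 1 - (1 - (𝐞 x : ℂ))⁻¹ = -(𝐞 x * (1 - (𝐞 x : ℂ))⁻¹) := by
    linear_combination -mul_inv_cancel₀ (sub_ne_zero.mpr hx.symm)
  rw [h, norm_neg, norm_mul, Circle.norm_coe, one_mul]

theorem norm_inv_one_sub_fourierChar_sub (hδ : 0 < δ) (hx : x ∈ Set.Icc δ (1 - δ))
    (hy : y ∈ Set.Icc δ (1 - δ)) (hxy : x ≤ y) :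
    ‖(1 - (𝐞 y : ℂ))⁻¹ - (1 - (𝐞 x : ℂ))⁻¹‖ = (Real.cot (π * x) - Real.cot (π * y)) / 2 := by
  have hmem : ∀ z ∈ Set.Icc δ (1 - δ), π * z ∈ Set.Ioo 0 π := fun z hz =>
    ⟨by have := hδ.trans_le hz.1; positivity, by nlinarith [hz.2, Real.pi_pos]⟩
  have hanti := antitoneOn_cot (hmem x hx) (hmem y hy)
    (mul_le_mul_of_nonneg_left hxy Real.pi_pos.le)
  rw [inv_one_sub_fourierChar (Real.sin_pos_of_mem_Ioo (hmem x hx)).ne',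
    inv_one_sub_fourierChar (Real.sin_pos_of_mem_Ioo (hmem y hy)).ne',
    show (1 + Complex.I * (Real.cot (π * y) : ℂ)) / 2 - (1 + Complex.I * Real.cot (π * x)) / 2
      = Complex.I * (((Real.cot (π * y) - Real.cot (π * x)) / 2 : ℝ) : ℂ) by push_cast; ring,
    norm_mul, Complex.norm_I, one_mul, Complex.norm_real, Real.norm_of_nonpos (by linarith)]
  ring

/- The Kusmin–Landau inequality. With `z k = 𝐞 (g k)`, `d k = g (k + 1) - g k` and
`c k = (1 - 𝐞 (d k))⁻¹` one has `z k = c k * (z k - z (k + 1))`; as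
`c k = (1 + i cot (π * d k)) / 2`, the norms of the differences of `c` telescope. -/
theorem norm_sum_range_fourierChar_le {g : ℕ → ℝ} (hδ : 0 < δ) (hδ' : δ ≤ 1) {n : ℕ}
    (hg : ∀ k, k + 1 < n → g (k + 1) - g k ∈ Set.Icc δ (1 - δ))
    (hmono : ∀ k, k + 2 < n → g (k + 1) - g k ≤ g (k + 2) - g (k + 1)) :
    ‖∑ k ∈ range n, (𝐞 (g k) : ℂ)‖ ≤ 1 / δ := by
  obtain rfl | rfl | ⟨n, rfl⟩ : n = 0 ∨ n = 1 ∨ ∃ m, n = m + 2 := by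
    rcases n with _ | _ | n <;> simp
  · simpa using hδ.le
  · rw [sum_range_one, Circle.norm_coe]
    exact one_le_one_div hδ hδ'
  set d : ℕ → ℝ := fun k => g (k + 1) - g k
  set c : ℕ → ℂ := fun k => (1 - (𝐞 (d k) : ℂ))⁻¹
  have hd : ∀ k ≤ n, d k ∈ Set.Icc δ (1 - δ) := fun k hk => hg k (by omega)
  have hne : ∀ k ≤ n, (𝐞 (d k) : ℂ) ≠ 1 := fun k hk => fourierChar_ne_one_of_mem_Icc hδ (hd k hk)
  have hsucc : ∀ k, (𝐞 (g (k + 1)) : ℂ) = 𝐞 (g k) * 𝐞 (d k) := fun k => by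
    rw [← Circle.coe_mul, ← AddChar.map_add_eq_mul, add_sub_cancel]
  have hdiff : ∀ k ∈ range n, ‖(c (k + 1) - c k) * (𝐞 (g (k + 1)) : ℂ)‖ ≤
      Real.cot (π * d k) / 2 - Real.cot (π * d (k + 1)) / 2 := fun k hk => by
    have hk : k < n := mem_range.mp hk
    rw [norm_mul, Circle.norm_coe, mul_one, norm_inv_one_sub_fourierChar_sub hδ (hd k hk.le)
      (hd (k + 1) hk) (hmono k (by omega)), sub_div]
  rw [sum_range_eq_of_mul_sub_succ (z := fun k => (𝐞 (g k) : ℂ)) (c := c) (n := n) fun k hk => by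
    rw [hsucc, ← mul_one_sub, mul_comm (𝐞 (g k) : ℂ),
      inv_mul_cancel_left₀ (sub_ne_zero.mpr (hne k hk).symm)]]
  calc ‖c 0 * (𝐞 (g 0) : ℂ) + ∑ k ∈ range n, (c (k + 1) - c k) * (𝐞 (g (k + 1)) : ℂ)
        + (1 - c n) * (𝐞 (g (n + 1)) : ℂ)‖
      ≤ ‖c 0‖ + (Real.cot (π * d 0) / 2 - Real.cot (π * d n) / 2) + ‖c n‖ := by
        refine norm_add₃_le.trans (add_le_add_three ?_ ?_ ?_)
        · rw [norm_mul, Circle.norm_coe, mul_one]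
        · exact (norm_sum_le_of_le _ hdiff).trans_eq (sum_range_sub' _ n)
        · rw [norm_mul, Circle.norm_coe, mul_one,
            norm_one_sub_inv_one_sub_fourierChar (hne n le_rfl)]
    _ ≤ 1 / (4 * δ) + (1 / (2 * δ) / 2 + 1 / (2 * δ) / 2) + 1 / (4 * δ) := by
        have h0 := abs_le.mp (abs_cot_pi_mul_le hδ (hd 0 n.zero_le))
        have hn := abs_le.mp (abs_cot_pi_mul_le hδ (hd n le_rfl))
        have := norm_inv_one_sub_fourierChar_le hδ (hd 0 n.zero_le)
        have := norm_inv_one_sub_fourierChar_le hδ (hd n le_rfl)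
        simp only [c]
        linarith
    _ = 1 / δ := by field_simp; norm_num

theorem norm_sum_Ioc_floor_fourierChar_le {f f' : ℝ → ℝ} {a b : ℝ}
    (hδ : 0 < δ) (hδ' : δ ≤ 1) (hf : ∀ x ∈ Set.Icc a b, HasDerivAt f (f' x) x)
    (hmono : MonotoneOn f' (Set.Icc a b)) (hf' : Set.MapsTo f' (Set.Icc a b) (Set.Icc δ (1 - δ))) :
    ‖∑ k ∈ Ioc ⌊a⌋₊ ⌊b⌋₊, (𝐞 (f k) : ℂ)‖ ≤ 1 / δ := by
  have hmem : ∀ k, ⌊a⌋₊ + 1 + k < ⌊b⌋₊ + 1 → ((⌊a⌋₊ + 1 + k : ℕ) : ℝ) ∈ Set.Icc a b :=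
    fun k hk => by
      refine ⟨(Nat.lt_floor_add_one a).le.trans ?_, (Nat.le_floor_iff' (by omega)).mp (by omega)⟩
      exact_mod_cast Nat.le_add_right _ k
  have hmvt : ∀ x, x ∈ Set.Icc a b → x + 1 ∈ Set.Icc a b →
      ∃ ξ ∈ Set.Icc a b, ξ ∈ Set.Ioo x (x + 1) ∧ f (x + 1) - f x = f' ξ := fun x hx hx' => by
    have hsub : Set.Icc x (x + 1) ⊆ Set.Icc a b := Set.Icc_subset_Icc hx.1 hx'.2
    obtain ⟨ξ, hξ, h⟩ := exists_hasDerivAt_eq_slope f f' (lt_add_one x)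
      (fun y hy => (hf y (hsub hy)).continuousAt.continuousWithinAt)
      fun y hy => hf y (hsub (Set.Ioo_subset_Icc_self hy))
    exact ⟨ξ, hsub (Set.Ioo_subset_Icc_self hξ), hξ, by rw [h, add_sub_cancel_left, div_one]⟩
  rw [← Ico_add_one_add_one_eq_Ioc, sum_Ico_eq_sum_range]
  refine norm_sum_range_fourierChar_le (g := fun k => f ((⌊a⌋₊ + 1 + k : ℕ) : ℝ)) hδ hδ' ?_ ?_
  · intro k hk
    obtain ⟨ξ, hξ, -, h⟩ := hmvt _ (hmem k (by omega))
      (by exact_mod_cast hmem (k + 1) (by omega))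
    have := hf' hξ
    rw [← h] at this
    simpa [add_assoc] using this
  · intro k hk
    obtain ⟨ξ, hξ, hξk, h⟩ := hmvt _ (hmem k (by omega))
      (by exact_mod_cast hmem (k + 1) (by omega))
    obtain ⟨ζ, hζ, hζk, h'⟩ := hmvt _ (hmem (k + 1) (by omega))
      (by exact_mod_cast hmem (k + 2) (by omega))
    have hξζ : ξ ≤ ζ := hξk.2.le.trans ((le_of_eq (by push_cast; ring)).trans hζk.1.le)
    have := hmono hξ hζ hξζ
    rw [← h, ← h'] at this
    simpa [add_assoc, one_add_one_eq_two] using this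

end KusminLandau

theorem norm_integral_inv_smul_deriv_le {E : Type*} [NormedAddCommGroup E] [NormedSpace ℝ E]
    [CompleteSpace E] {v v' : ℝ → E} {K R M : ℝ} (hK : 0 < K) (hKR : K ≤ R)
    (hv : ∀ x, HasDerivAt v (v' x) x) (hv' : Continuous v') (hM : ∀ x, ‖v x‖ ≤ M) :
    ‖∫ x in K..R, x⁻¹ • v' x‖ ≤ 2 * M / K := by
  have hpos {x : ℝ} (hx : x ∈ Set.uIcc K R) : x ≠ 0 := by
    rw [Set.uIcc_of_le hKR] at hx
    exact (hK.trans_le hx.1).ne'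
  have hu : ∀ x ∈ Set.uIcc K R, HasDerivAt (fun x : ℝ => x⁻¹) (-(x ^ 2)⁻¹) x :=
    fun x hx => hasDerivAt_inv (hpos hx)
  have hu' : IntervalIntegrable (fun x : ℝ => -(x ^ 2)⁻¹) volume K R :=
    (ContinuousOn.inv₀ (by fun_prop) fun x hx => pow_ne_zero 2 (hpos hx)).neg.intervalIntegrable
  have hbound : ‖∫ x in K..R, -(x ^ 2)⁻¹ • v x‖ ≤ M * (K⁻¹ - R⁻¹) := by
    have hint : ∫ x in K..R, M * (x ^ 2)⁻¹ = M * (K⁻¹ - R⁻¹) := by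
      have := intervalIntegral.integral_eq_sub_of_hasDerivAt hu hu'
      rw [intervalIntegral.integral_neg] at this
      rw [intervalIntegral.integral_const_mul]
      linear_combination -M * this
    rw [← hint]
    refine intervalIntegral.norm_integral_le_of_norm_le hKR (ae_of_all _ fun x _ => ?_)
      (by simpa using hu'.neg.const_mul M)
    rw [norm_smul, norm_neg, Real.norm_of_nonneg (by positivity), mul_comm]
    gcongr
    exact hM x
  have hend {x : ℝ} (hx : 0 < x) : ‖x⁻¹ • v x‖ ≤ M * x⁻¹ := by
    rw [norm_smul, Real.norm_of_nonneg (by positivity), mul_comm]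
    gcongr
    exact hM x
  rw [intervalIntegral.integral_smul_deriv_eq_deriv_smul hu (fun x _ => hv x) hu'
    (hv'.intervalIntegrable K R)]
  calc _ ≤ ‖R⁻¹ • v R‖ + ‖K⁻¹ • v K‖ + ‖∫ x in K..R, -(x ^ 2)⁻¹ • v x‖ :=
        (norm_sub_le _ _).trans (by gcongr; exact norm_sub_le _ _)
    _ ≤ M * R⁻¹ + M * K⁻¹ + M * (K⁻¹ - R⁻¹) := by
        gcongr
        exacts [hend (hK.trans_le hKR), hend hK]
    _ = 2 * M / K := by ring

theorem norm_integral_cexp_neg_mul_sq_le {b : ℂ} (hb : 0 ≤ b.re) (hb0 : b ≠ 0) {K R : ℝ}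
    (hK : 0 < K) (hKR : K ≤ R) :
    ‖∫ x in K..R, Complex.exp (-b * (x : ℂ) ^ 2)‖ ≤ 1 / (‖b‖ * K) := by
  have hderiv (x : ℝ) : HasDerivAt (fun x : ℝ => -Complex.exp (-b * (x : ℂ) ^ 2) / (2 * b))
      (x * Complex.exp (-b * (x : ℂ) ^ 2)) x := by
    refine ((((hasDerivAt_pow 2 (x : ℂ)).const_mul (-b)).cexp.neg.div_const
      (2 * b)).comp_ofReal).congr_deriv ?_
    push_cast
    field_simp
  have hnorm (x : ℝ) : ‖-Complex.exp (-b * (x : ℂ) ^ 2) / (2 * b)‖ ≤ 1 / (2 * ‖b‖) := by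
    rw [norm_div, norm_neg, norm_mul, Complex.norm_ofNat, Complex.norm_exp]
    gcongr
    rw [Real.exp_le_one_iff, ← Complex.ofReal_pow, Complex.re_mul_ofReal, Complex.neg_re]
    nlinarith [sq_nonneg x]
  have h := norm_integral_inv_smul_deriv_le hK hKR hderiv (by fun_prop) hnorm
  have hcongr : ∫ x in K..R, x⁻¹ • ((x : ℂ) * Complex.exp (-b * (x : ℂ) ^ 2))
      = ∫ x in K..R, Complex.exp (-b * (x : ℂ) ^ 2) := by
    refine intervalIntegral.integral_congr fun x hx => ?_
    rw [Set.uIcc_of_le hKR] at hx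
    have : (x : ℂ) ≠ 0 := Complex.ofReal_ne_zero.mpr (hK.trans_le hx.1).ne'
    simp [this]
  rw [hcongr] at h
  refine h.trans_eq ?_
  field_simp

theorem norm_integral_gaussian_sub_integral_le {b : ℂ} (hb : 0 < b.re) {K : ℝ} (hK : 0 < K) :
    ‖(∫ x : ℝ, Complex.exp (-b * (x : ℂ) ^ 2)) - ∫ x in -K..K, Complex.exp (-b * (x : ℂ) ^ 2)‖
      ≤ 2 / (‖b‖ * K) := by
  have hb0 : b ≠ 0 := by rintro rfl; simp at hb
  have hint (u v : ℝ) :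
      IntervalIntegrable (fun x : ℝ => Complex.exp (-b * (x : ℂ) ^ 2)) volume u v :=
    Continuous.intervalIntegrable (by fun_prop) u v
  refine le_of_tendsto ((intervalIntegral_tendsto_integral (integrable_cexp_neg_mul_sq hb)
    tendsto_neg_atTop_atBot tendsto_id).sub_const _).norm ?_
  filter_upwards [eventually_ge_atTop K] with R hR
  have hsymm : ∫ x in -R..-K, Complex.exp (-b * (x : ℂ) ^ 2)
      = ∫ x in K..R, Complex.exp (-b * (x : ℂ) ^ 2) := by
    rw [← intervalIntegral.integral_comp_neg]
    simp
  have hsplit : (∫ x in -R..R, Complex.exp (-b * (x : ℂ) ^ 2))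
      - ∫ x in -K..K, Complex.exp (-b * (x : ℂ) ^ 2)
      = 2 * ∫ x in K..R, Complex.exp (-b * (x : ℂ) ^ 2) := by
    have h₁ := intervalIntegral.integral_add_adjacent_intervals (hint (-R) (-K)) (hint (-K) K)
    have h₂ := intervalIntegral.integral_add_adjacent_intervals (hint (-R) K) (hint K R)
    rw [hsymm] at h₁
    linear_combination -h₁ - h₂
  rw [id, hsplit, norm_mul, Complex.norm_ofNat, ← mul_one_div]
  gcongr
  exact norm_integral_cexp_neg_mul_sq_le hb.le hb0 hK hR

theorem norm_gaussian_sub_integral_le {b : ℂ} (hb : 0 ≤ b.re) (hb0 : b ≠ 0) {K : ℝ}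
    (hK : 0 < K) :
    ‖(π / b) ^ (1 / 2 : ℂ) - ∫ x in -K..K, Complex.exp (-b * (x : ℂ) ^ 2)‖ ≤ 2 / (‖b‖ * K) := by
  have hslit : π / b ∈ Complex.slitPlane := by
    have hns : 0 < Complex.normSq b := Complex.normSq_pos.mpr hb0
    rw [Complex.mem_slitPlane_iff, div_eq_mul_inv, Complex.re_ofReal_mul, Complex.im_ofReal_mul,
      Complex.inv_re, Complex.inv_im]
    rcases hb.lt_or_eq with h | h
    · left
      positivity
    · right
      have him : b.im ≠ 0 := fun him => hb0 (Complex.ext h.symm him)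
      simp [him, hb0, Real.pi_ne_zero]
  have hcpow : ContinuousAt (fun ε : ℝ => (π / (b + ε)) ^ (1 / 2 : ℂ)) 0 :=
    ContinuousAt.cpow (ContinuousAt.div (by fun_prop) (by fun_prop) (by simpa))
      continuousAt_const (by simpa)
  have hint : Continuous fun ε : ℝ => ∫ x in -K..K, Complex.exp (-(b + ε) * (x : ℂ) ^ 2) :=
    intervalIntegral.continuous_parametric_intervalIntegral_of_continuous' (by fun_prop) _ _
  have hbound : ContinuousAt (fun ε : ℝ => 2 / (‖b + ε‖ * K)) 0 :=
    ContinuousAt.div (by fun_prop) (by fun_prop) (by simp [hb0, hK.ne'])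
  have h := le_of_tendsto_of_tendsto
    ((hcpow.sub hint.continuousAt).norm.tendsto.mono_left nhdsWithin_le_nhds)
    (hbound.tendsto.mono_left (nhdsWithin_le_nhds (s := Set.Ioi 0))) ?_
  · simpa using h
  · filter_upwards [self_mem_nhdsWithin] with ε hε
    have hre : 0 < (b + ε).re := by
      simpa using add_pos_of_nonneg_of_pos hb hε
    rw [Pi.sub_apply, ← integral_gaussian_complex hre]
    exact norm_integral_gaussian_sub_integral_le hre hK

theorem norm_fresnel_sub_integral_le {K : ℝ} (hK : 0 < K) :
    ‖(1 / (2 * Complex.I)) ^ (1 / 2 : ℂ) - ∫ x in -K..K, (𝐞 (-x ^ 2) : ℂ)‖ ≤ 1 / K := by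
  have hpi : (π : ℂ) ≠ 0 := Complex.ofReal_ne_zero.mpr Real.pi_ne_zero
  have h := norm_gaussian_sub_integral_le (b := 2 * π * Complex.I) (by simp)
    (by simp [Complex.I_ne_zero]) hK
  have hbase : (π : ℂ) / (2 * π * Complex.I) = 1 / (2 * Complex.I) := by field_simp
  have hexp (x : ℝ) :
      Complex.exp (-(2 * π * Complex.I) * (x : ℂ) ^ 2) = (𝐞 (-x ^ 2) : ℂ) := by
    rw [Real.fourierChar_apply]
    push_cast
    ring_nf
  have hnorm : ‖(2 * π * Complex.I : ℂ)‖ = 2 * π := by simp [abs_of_pos Real.pi_pos]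
  simp only [hbase, hexp, hnorm] at h
  refine h.trans ?_
  rw [div_le_div_iff₀ (by positivity) hK]
  nlinarith [Real.pi_gt_three]

theorem norm_fresnel_smul_sub_integral_le {r h : ℝ} (hr : 0 < r) (hh : 0 < h) :
    ‖(√r)⁻¹ • (1 / (2 * Complex.I)) ^ (1 / 2 : ℂ) - ∫ v in -h..h, (𝐞 (-(r * v ^ 2)) : ℂ)‖
      ≤ 1 / (r * h) := by
  have hr' : 0 < √r := Real.sqrt_pos.mpr hr
  have hscale : ∫ v in -h..h, (𝐞 (-(r * v ^ 2)) : ℂ)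
      = (√r)⁻¹ • ∫ y in -(√r * h)..√r * h, (𝐞 (-y ^ 2) : ℂ) := by
    have hsub := intervalIntegral.integral_comp_mul_left (a := -h) (b := h)
      (fun y : ℝ => (𝐞 (-y ^ 2) : ℂ)) hr'.ne'
    rw [mul_neg] at hsub
    rw [← hsub]
    simp only [mul_pow, Real.sq_sqrt hr.le]
  rw [hscale, ← smul_sub, norm_smul, Real.norm_of_nonneg (by positivity)]
  calc (√r)⁻¹ * _ ≤ (√r)⁻¹ * (1 / (√r * h)) := by
        gcongr
        exact norm_fresnel_sub_integral_le (by positivity)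
    _ = 1 / (√r ^ 2 * h) := by field_simp
    _ = 1 / (r * h) := by rw [Real.sq_sqrt hr.le]

theorem sum_range_smul_eq_sub {R M : Type*} [Ring R] [AddCommGroup M] [Module R M] (f : ℕ → R)
    (g : ℕ → M) (n : ℕ) :
    ∑ k ∈ range n, f k • g k = f n • ∑ k ∈ range n, g k
      - ∑ k ∈ range n, (f (k + 1) - f k) • ∑ i ∈ range (k + 1), g i := by
  induction n with
  | zero => simp
  | succ n ih =>
    rw [sum_range_succ, ih, sum_range_succ (fun k => (f (k + 1) - f k) • _), sum_range_succ g]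
    simp only [sub_smul, smul_add]
    abel

section WeightedMean

variable {E : Type*} [NormedAddCommGroup E] [NormedSpace ℝ E] {a : ℕ → E} {c : E} {p : ℝ}

theorem hasMean_zero_iff_isLittleO :
    HasMean a 0 ↔ (fun N => ∑ k ∈ range N, a k) =o[atTop] fun N => (N : ℝ) := by
  rw [HasMean, tendsto_zero_iff_norm_tendsto_zero, ← isLittleO_norm_left,
    isLittleO_iff_tendsto' (by filter_upwards [eventually_gt_atTop 0] with N _ h; simp_all)]
  simp only [norm_smul, norm_inv, Real.norm_natCast, div_eq_inv_mul]

theorem HasMean.isLittleO_sum_rpow_smul (hp : 0 < p) (ha : HasMean a 0) :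
    (fun N => ∑ k ∈ range N, (k : ℝ) ^ p • a k) =o[atTop] fun N => (N : ℝ) ^ (p + 1) := by
  have hA := hasMean_zero_iff_isLittleO.mp ha
  have hrpow (N : ℕ) : (N : ℝ) ^ (p + 1) = (N : ℝ) ^ p * N := by
    rw [Real.rpow_add' (by positivity) (by positivity), Real.rpow_one]
  have hdiff (k : ℕ) : 0 ≤ ((k + 1 : ℕ) : ℝ) ^ p - (k : ℝ) ^ p :=
    sub_nonneg.mpr (by gcongr; omega)
  have htel (N : ℕ) :
      ∑ k ∈ range N, (((k + 1 : ℕ) : ℝ) ^ p - (k : ℝ) ^ p) = (N : ℝ) ^ p := by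
    rw [sum_range_sub (fun k : ℕ => (k : ℝ) ^ p)]
    simp [hp.ne']
  have hA' : (fun k => ∑ i ∈ range (k + 1), a i) =o[atTop] fun k => ((k + 1 : ℕ) : ℝ) :=
    hA.comp_tendsto (tendsto_add_atTop_nat 1)
  have hterm : (fun k : ℕ => (((k + 1 : ℕ) : ℝ) ^ p - (k : ℝ) ^ p) • ∑ i ∈ range (k + 1), a i)
      =o[atTop] fun k : ℕ => (((k + 1 : ℕ) : ℝ) ^ p - (k : ℝ) ^ p) * (k + 1 : ℕ) :=
    (isBigO_refl (fun k : ℕ => ((k + 1 : ℕ) : ℝ) ^ p - (k : ℝ) ^ p) _).smul_isLittleO hA'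
  simp only [hrpow]
  refine IsLittleO.congr_left ?_ fun N =>
    (sum_range_smul_eq_sub (fun k : ℕ => (k : ℝ) ^ p) a N).symm
  refine ((isBigO_refl (fun N : ℕ => (N : ℝ) ^ p) atTop).smul_isLittleO hA).sub
    ((hterm.sum_range (fun k => mul_nonneg (hdiff k) (by positivity)) ?_).trans_isBigO ?_)
  · refine tendsto_atTop_mono (fun N => ?_)
      ((tendsto_rpow_atTop hp).comp tendsto_natCast_atTop_atTop)
    rw [Function.comp_apply, ← htel]
    gcongr with k
    exact le_mul_of_one_le_right (hdiff k) (by simp)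
  · refine IsBigO.of_bound' (Eventually.of_forall fun N => ?_)
    rw [Real.norm_of_nonneg (sum_nonneg fun k _ => mul_nonneg (hdiff k) (by positivity)),
      Real.norm_of_nonneg (by positivity), ← htel,
      smul_eq_mul, sum_mul]
    gcongr with k hk
    · exact hdiff k
    · exact mem_range.mp hk

theorem tendsto_sum_rpow_div_rpow_add_one (hp : 0 ≤ p) :
    Tendsto (fun N : ℕ => (∑ k ∈ range N, (k : ℝ) ^ p) / (N : ℝ) ^ (p + 1)) atTop
      (𝓝 (p + 1)⁻¹) := by
  have hmono (N : ℕ) : MonotoneOn (fun x : ℝ => x ^ p) (Set.Icc (0 : ℕ) N) :=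
    (Real.monotoneOn_rpow_Ici_of_exponent_nonneg hp).mono fun x hx => by simpa using hx.1
  have hint (N : ℕ) : ∫ x in ((0 : ℕ) : ℝ)..N, x ^ p = (N : ℝ) ^ (p + 1) * (p + 1)⁻¹ := by
    rw [integral_rpow (.inl (by linarith)), Nat.cast_zero, Real.zero_rpow (by positivity),
      sub_zero, div_eq_mul_inv]
  have hupper (N : ℕ) : ∑ k ∈ range N, (k : ℝ) ^ p ≤ (N : ℝ) ^ (p + 1) * (p + 1)⁻¹ := by
    simpa only [← range_eq_Ico, hint] using (hmono N).sum_le_integral_Ico N.zero_le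
  have hlower (N : ℕ) :
      (N : ℝ) ^ (p + 1) * (p + 1)⁻¹ - (N : ℝ) ^ p ≤ ∑ k ∈ range N, (k : ℝ) ^ p := by
    have h := (hmono N).integral_le_sum_Ico N.zero_le
    have hshift := sum_range_succ' (fun k : ℕ => (k : ℝ) ^ p) N
    rw [sum_range_succ] at hshift
    rw [hint, ← range_eq_Ico] at h
    linarith [Real.rpow_nonneg (Nat.cast_nonneg (α := ℝ) 0) p]
  refine tendsto_of_tendsto_of_tendsto_of_le_of_le' (g := fun N : ℕ => (p + 1)⁻¹ - (N : ℝ)⁻¹)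
    (by simpa using tendsto_inv_atTop_nhds_zero_nat.const_sub ((p + 1)⁻¹ : ℝ))
    tendsto_const_nhds ?_ ?_
  all_goals
    filter_upwards [eventually_gt_atTop 0] with N hN
    have hN' : (0 : ℝ) < N := Nat.cast_pos.mpr hN
  · rw [le_div_iff₀ (by positivity)]
    refine Eq.trans_le ?_ (hlower N)
    rw [Real.rpow_add_one hN'.ne']
    field_simp
  · rw [div_le_iff₀ (by positivity), mul_comm]
    exact hupper N

theorem HasMean.tendsto_sum_rpow_smul (hp : 0 < p) (ha : HasMean a c) :
    Tendsto (fun N : ℕ => ((N : ℝ) ^ (p + 1))⁻¹ • ∑ k ∈ range N, (k : ℝ) ^ p • a k) atTop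
      (𝓝 ((p + 1)⁻¹ • c)) := by
  have hzero : HasMean (fun k => a k - c) 0 := by
    simpa [sub_eq_add_neg] using ha.add (.const (-c))
  have hrem : Tendsto
      (fun N : ℕ => ((N : ℝ) ^ (p + 1))⁻¹ • ∑ k ∈ range N, (k : ℝ) ^ p • (a k - c)) atTop
      (𝓝 0) :=
    (hzero.isLittleO_sum_rpow_smul hp).tendsto_inv_smul_nhds_zero
  simpa only [smul_sub, sum_sub_distrib, ← sum_smul, smul_smul, ← div_eq_inv_mul,
    sub_add_cancel, zero_add]
    using hrem.add ((tendsto_sum_rpow_div_rpow_add_one hp.le).smul_const c)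

theorem HasMean.tendsto_sum_of_sub_isLittleO {b : ℕ → E} (hp : 0 < p) (ha : HasMean a c)
    (hb : (fun k => b k - (k : ℝ) ^ p • a k) =o[atTop] fun k => (k : ℝ) ^ p) :
    Tendsto (fun N : ℕ => ((N : ℝ) ^ (p + 1))⁻¹ • ∑ k ∈ range N, b k) atTop
      (𝓝 ((p + 1)⁻¹ • c)) := by
  have hsum := tendsto_sum_rpow_div_rpow_add_one hp.le
  have hpow : Tendsto (fun N : ℕ => (N : ℝ) ^ (p + 1)) atTop atTop :=
    (tendsto_rpow_atTop (by positivity)).comp tendsto_natCast_atTop_atTop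
  have hpos : ∀ᶠ N : ℕ in atTop, (N : ℝ) ^ (p + 1) ≠ 0 := hpow.eventually_ne_atTop 0
  have htop : Tendsto (fun N : ℕ => ∑ k ∈ range N, (k : ℝ) ^ p) atTop atTop := by
    refine (hsum.pos_mul_atTop (by positivity) hpow).congr' ?_
    filter_upwards [hpos] with N hN using div_mul_cancel₀ _ hN
  have hrem := (hb.sum_range (fun k => by positivity) htop).trans_isBigO
    (isBigO_of_div_tendsto_nhds (hpos.mono fun N hN h => absurd h hN) _ hsum)
  simpa only [sum_sub_distrib, smul_sub, sub_add_cancel, zero_add] using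
    hrem.tendsto_inv_smul_nhds_zero.add (ha.tendsto_sum_rpow_smul hp)

end WeightedMean

section SumIntegral

variable {f f' : ℝ → ℂ} {a b V : ℝ}

theorem sum_Ioc_floor_sub_integral (ha : 0 ≤ a) (hab : a ≤ b)
    (hf : ∀ x ∈ Set.Icc a b, HasDerivAt f (f' x) x) (hf' : ContinuousOn f' (Set.Icc a b)) :
    ∑ k ∈ Ioc ⌊a⌋₊ ⌊b⌋₊, f k - ∫ x in a..b, f x
      = (⌊b⌋₊ + 1 - b : ℝ) * f b - (⌊a⌋₊ + 1 - a : ℝ) * f a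
        - ∫ x in a..b, (⌊x⌋₊ + 1 - x : ℝ) * f' x := by
  have hderiv : Set.EqOn f' (deriv f) (Set.Icc a b) := fun x hx => (hf x hx).deriv.symm
  have hcount (n : ℕ) : ∑ _k ∈ Icc 0 n, (1 : ℂ) = n + 1 := by simp
  have hintOn : IntegrableOn (deriv f) (Set.Icc a b) :=
    hf'.integrableOn_Icc.congr_fun hderiv measurableSet_Icc
  have hstep : IntervalIntegrable (fun x => deriv f x * (⌊x⌋₊ + 1)) volume a b := by
    rw [intervalIntegrable_iff_integrableOn_Icc_of_le hab]
    simpa only [hcount] using integrableOn_mul_sum_Icc (m := 0) (fun _ => 1) ha hintOn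
  have hlin : IntervalIntegrable (fun x : ℝ => x * f' x) volume a b :=
    ContinuousOn.intervalIntegrable_of_Icc hab (by fun_prop)
  have hAbel := sum_mul_eq_sub_sub_integral_mul (fun _ => 1) ha hab
    (fun x hx => (hf x hx).differentiableAt) hintOn
  rw [← intervalIntegral.integral_of_le hab] at hAbel
  simp only [hcount, mul_one] at hAbel
  rw [← Set.uIcc_of_le hab] at hf hf' hderiv
  have hparts := intervalIntegral.integral_mul_deriv_eq_deriv_mul
    (fun x _ => Complex.ofRealCLM.hasDerivAt (x := x)) hf (by simp) hf'.intervalIntegrable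
  simp only [Complex.ofRealCLM_apply, Complex.ofReal_one, one_mul] at hparts
  have hsplit : ∫ x in a..b, (⌊x⌋₊ + 1 - x : ℝ) * f' x
      = (∫ x in a..b, deriv f x * (⌊x⌋₊ + 1)) - ∫ x in a..b, x * f' x := by
    rw [← intervalIntegral.integral_sub hstep hlin]
    refine intervalIntegral.integral_congr fun x hx => ?_
    simp only [← hderiv hx]
    push_cast
    ring
  rw [hAbel, hsplit, hparts]
  push_cast
  ring

theorem norm_sum_Ioc_floor_sub_integral_le (ha : 0 ≤ a) (hab : a ≤ b)
    (hf : ∀ x ∈ Set.Icc a b, HasDerivAt f (f' x) x) (hf' : ContinuousOn f' (Set.Icc a b))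
    (hV : ∀ x ∈ Set.Icc a b, ‖f' x‖ ≤ V) :
    ‖∑ k ∈ Ioc ⌊a⌋₊ ⌊b⌋₊, f k - ∫ x in a..b, f x‖ ≤ ‖f a‖ + ‖f b‖ + V * (b - a) := by
  have hfrac {x : ℝ} (hx : 0 ≤ x) : ‖((⌊x⌋₊ + 1 - x : ℝ) : ℂ)‖ ≤ 1 := by
    rw [Complex.norm_real, Real.norm_of_nonneg (by linarith [Nat.lt_floor_add_one x])]
    linarith [Nat.floor_le hx]
  have hmul {x : ℝ} (hx : 0 ≤ x) (z : ℂ) : ‖(⌊x⌋₊ + 1 - x : ℝ) * z‖ ≤ ‖z‖ := by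
    rw [norm_mul]
    exact mul_le_of_le_one_left (norm_nonneg z) (hfrac hx)
  have hint : ‖∫ x in a..b, (⌊x⌋₊ + 1 - x : ℝ) * f' x‖ ≤ V * (b - a) := by
    rw [← abs_of_nonneg (sub_nonneg.mpr hab)]
    refine intervalIntegral.norm_integral_le_of_norm_le_const fun x hx => ?_
    rw [Set.uIoc_of_le hab] at hx
    exact (hmul (ha.trans hx.1.le) _).trans (hV x ⟨hx.1.le, hx.2⟩)
  rw [sum_Ioc_floor_sub_integral ha hab hf hf']
  refine (norm_sub_le _ _).trans (add_le_add ((norm_sub_le _ _).trans ?_) hint)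
  rw [add_comm]
  exact add_le_add (hmul ha _) (hmul (ha.trans hab) _)

end SumIntegral

theorem isLittleO_rpow_rpow_atTop {p q : ℝ} (h : p < q) :
    (fun x : ℝ => x ^ p) =o[atTop] fun x => x ^ q := by
  have hne : ∀ᶠ x : ℝ in atTop, x ^ q = 0 → x ^ p = 0 := by
    filter_upwards [eventually_gt_atTop 0] with x hx h0
    exact absurd h0 (by positivity)
  refine (isLittleO_iff_tendsto' hne).mpr ((tendsto_rpow_neg_atTop (sub_pos.mpr h)).congr' ?_)
  filter_upwards [eventually_gt_atTop 0] with x hx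
  rw [neg_sub, Real.rpow_sub hx]

theorem norm_sum_range_sub_sum_range_le {E : Type*} [SeminormedAddCommGroup E] {a : ℕ → E}
    (ha : ∀ k, ‖a k‖ ≤ 1) (m n : ℕ) :
    ‖∑ k ∈ range m, a k - ∑ k ∈ range n, a k‖ ≤ |(m : ℝ) - n| := by
  wlog hnm : n ≤ m generalizing m n
  · rw [norm_sub_rev, abs_sub_comm]
    exact this n m (le_of_not_ge hnm)
  rw [← sum_Ico_eq_sub _ hnm, ← Nat.cast_sub hnm, Nat.abs_cast]
  simpa using norm_sum_le_of_le (Ico n m) fun k _ => ha k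

theorem norm_fourierChar_sub_le (x y : ℝ) : ‖(𝐞 x : ℂ) - 𝐞 y‖ ≤ 2 * π * |x - y| := by
  have hfactor : (𝐞 x : ℂ) - 𝐞 y = -(𝐞 y * (1 - 𝐞 (x - y))) := by
    rw [mul_sub, ← Circle.coe_mul, ← AddChar.map_add_eq_mul, add_sub_cancel]
    ring
  rw [hfactor, norm_neg, norm_mul, Circle.norm_coe, one_mul, norm_one_sub_fourierChar, mul_assoc]
  refine mul_le_mul_of_nonneg_left (Real.abs_sin_le_abs.trans_eq ?_) zero_le_two
  rw [abs_mul, abs_of_pos Real.pi_pos]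

theorem hasDerivAt_fourierChar_comp {f : ℝ → ℝ} {f' x : ℝ} (hf : HasDerivAt f f' x) :
    HasDerivAt (fun y => (𝐞 (f y) : ℂ)) (f' • (2 * π * Complex.I * 𝐞 (f x))) x :=
  (Real.hasDerivAt_fourierChar (f x)).scomp x hf

theorem hasDerivAt_rpow_three_halves (x : ℝ) :
    HasDerivAt (fun y : ℝ => y ^ (3 / 2 : ℝ)) (3 / 2 * √x) x := by
  have h := Real.hasDerivAt_rpow_const (x := x) (p := 3 / 2) (.inr (by norm_num))
  rwa [show (3 / 2 - 1 : ℝ) = 1 / 2 by norm_num, ← Real.sqrt_eq_rpow] at h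

theorem sq_rpow_three_halves {y : ℝ} (hy : 0 ≤ y) : (y ^ 2) ^ (3 / 2 : ℝ) = y ^ 3 := by
  rw [← Real.rpow_natCast_mul hy, ← Real.rpow_natCast]
  norm_num

section StationaryPhase

variable {s h : ℝ} {j : ℕ}

/-- The square root of the stationary point of the phase `x ↦ j x - s x ^ (3 / 2)`. All estimates
around the stationary points are made in the variable `√x`, in which this phase is a polynomial. -/
noncomputable def stationaryRoot (s : ℝ) (j : ℕ) : ℝ :=
  2 * j / (3 * s)

theorem stationaryRoot_nonneg (hs : 0 ≤ s) : 0 ≤ stationaryRoot s j := by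
  unfold stationaryRoot
  positivity

theorem three_mul_mul_stationaryRoot (hs : s ≠ 0) : 3 * s * stationaryRoot s j = 2 * j := by
  unfold stationaryRoot
  field_simp

theorem phase_stationaryRoot_add (hs : s ≠ 0) {v : ℝ} (hv : 0 ≤ stationaryRoot s j + v) :
    j * (stationaryRoot s j + v) ^ 2 - s * ((stationaryRoot s j + v) ^ 2) ^ (3 / 2 : ℝ)
      = 4 / 27 * (s ^ 2)⁻¹ * j ^ 3 + -(j * v ^ 2 + s * v ^ 3) := by
  rw [sq_rpow_three_halves hv, stationaryRoot]
  field_simp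
  ring

theorem fourierChar_natCast_mul_sub (j k : ℕ) (x : ℝ) : 𝐞 (j * k - x) = 𝐞 (-x) := by
  have h1 : 𝐞 ((j * k : ℕ) : ℝ) = 1 := fourierChar_eq_one_iff.mpr ⟨(j * k : ℕ), by simp⟩
  rw [sub_eq_add_neg, AddChar.map_add_eq_mul, ← Nat.cast_mul, h1, one_mul]

theorem norm_sum_window_sub_integral_le (hs : 0 < s) (hh : 0 ≤ h) (hw : h ≤ stationaryRoot s j) :
    ‖∑ k ∈ Ioc ⌊(stationaryRoot s j - h) ^ 2⌋₊ ⌊(stationaryRoot s j + h) ^ 2⌋₊,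
        (𝐞 (-(s * (k : ℝ) ^ (3 / 2 : ℝ))) : ℂ)
      - ∫ x in (stationaryRoot s j - h) ^ 2..(stationaryRoot s j + h) ^ 2,
        (𝐞 (j * x - s * x ^ (3 / 2 : ℝ)) : ℂ)‖ ≤ 2 + 8 * π * j * h ^ 2 := by
  set w := stationaryRoot s j
  have hsw : 3 * s * w = 2 * j := three_mul_mul_stationaryRoot hs.ne'
  have hderiv (x : ℝ) := hasDerivAt_fourierChar_comp
    (((hasDerivAt_id x).const_mul (j : ℝ)).fun_sub ((hasDerivAt_rpow_three_halves x).const_mul s))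
  have hV : ∀ x ∈ Set.Icc ((w - h) ^ 2) ((w + h) ^ 2),
      ‖(j * 1 - s * (3 / 2 * √x)) • (2 * π * Complex.I * 𝐞 (j * x - s * x ^ (3 / 2 : ℝ)) : ℂ)‖
        ≤ 3 * π * s * h := fun x hx => by
    have hlo : w - h ≤ √x := Real.le_sqrt_of_sq_le hx.1
    have hhi : √x ≤ w + h := Real.sqrt_le_iff.mpr ⟨by linarith, hx.2⟩
    have hdist : |j * 1 - s * (3 / 2 * √x)| ≤ 3 / 2 * s * h := by
      rw [show j * 1 - s * (3 / 2 * √x) = 3 / 2 * s * (w - √x) by linear_combination -hsw / 2,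
        abs_mul, abs_of_pos (by positivity)]
      gcongr
      rw [abs_le]
      constructor <;> linarith
    rw [norm_smul, Real.norm_eq_abs, norm_mul, Circle.norm_coe]
    have hnorm : ‖(2 * π * Complex.I : ℂ)‖ = 2 * π := by simp [abs_of_pos Real.pi_pos]
    rw [hnorm, mul_one (2 * π)]
    calc _ ≤ 3 / 2 * s * h * (2 * π) := mul_le_mul_of_nonneg_right hdist (by positivity)
      _ = 3 * π * s * h := by ring
  have hEM := norm_sum_Ioc_floor_sub_integral_le (sq_nonneg (w - h)) (by nlinarith)
    (fun x _ => hderiv x) (by fun_prop (disch := norm_num)) hV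
  simp only [id, fourierChar_natCast_mul_sub, Circle.norm_coe] at hEM
  refine hEM.trans_eq ?_
  linear_combination 4 * π * h ^ 2 * hsw

theorem integral_window_eq (hs : 0 < s) (hh : 0 ≤ h) (hw : h ≤ stationaryRoot s j) :
    ∫ x in (stationaryRoot s j - h) ^ 2..(stationaryRoot s j + h) ^ 2,
        (𝐞 (j * x - s * x ^ (3 / 2 : ℝ)) : ℂ)
      = 𝐞 (4 / 27 * (s ^ 2)⁻¹ * (j : ℝ) ^ 3) *
        ∫ v in -h..h, (2 * (stationaryRoot s j + v)) • (𝐞 (-(j * v ^ 2 + s * v ^ 3)) : ℂ) := by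
  have hderiv (v : ℝ) :
      HasDerivAt (fun v => (stationaryRoot s j + v) ^ 2) (2 * (stationaryRoot s j + v)) v := by
    simpa using ((hasDerivAt_id v).const_add (stationaryRoot s j)).fun_pow 2
  have hg : Continuous fun x : ℝ => (𝐞 (j * x - s * x ^ (3 / 2 : ℝ)) : ℂ) := by
    fun_prop (disch := norm_num)
  rw [sub_eq_add_neg, ← intervalIntegral.integral_deriv_smul_comp
    (f := fun v => (stationaryRoot s j + v) ^ 2) (fun v _ => hderiv v) (by fun_prop) hg,
    ← intervalIntegral.integral_const_mul]
  refine intervalIntegral.integral_congr fun v hv => ?_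
  rw [Set.uIcc_of_le (by linarith)] at hv
  have hphase := phase_stationaryRoot_add hs.ne' (j := j) (v := v) (by linarith [hv.1])
  simp only [Function.comp_apply, hphase, AddChar.map_add_eq_mul, Circle.coe_mul, mul_smul_comm]

theorem norm_integral_chirp_sub_le (hs : 0 < s) (hh : 0 ≤ h) :
    ‖(∫ v in -h..h, (2 * (stationaryRoot s j + v)) • (𝐞 (-(j * v ^ 2 + s * v ^ 3)) : ℂ))
      - (2 * stationaryRoot s j) • ∫ v in -h..h, (𝐞 (-(j * v ^ 2)) : ℂ)‖
      ≤ 4 * h ^ 2 + 16 / 3 * π * j * h ^ 4 := by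
  set w := stationaryRoot s j
  have hsw : 3 * s * w = 2 * j := three_mul_mul_stationaryRoot hs.ne'
  have hw : 0 ≤ w := stationaryRoot_nonneg hs.le
  have hpoint : ∀ v ∈ Set.uIoc (-h) h,
      ‖(2 * (w + v)) • (𝐞 (-(j * v ^ 2 + s * v ^ 3)) : ℂ) - (2 * w) • (𝐞 (-(j * v ^ 2)) : ℂ)‖
        ≤ 2 * h + 4 * π * w * s * h ^ 3 := fun v hv => by
    rw [Set.uIoc_of_le (by linarith)] at hv
    have hvh : |v| ≤ h := abs_le.mpr ⟨hv.1.le, hv.2⟩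
    have hsplit : (2 * (w + v)) • (𝐞 (-(j * v ^ 2 + s * v ^ 3)) : ℂ)
          - (2 * w) • (𝐞 (-(j * v ^ 2)) : ℂ)
        = (2 * v) • (𝐞 (-(j * v ^ 2 + s * v ^ 3)) : ℂ)
          + (2 * w) • ((𝐞 (-(j * v ^ 2 + s * v ^ 3)) : ℂ) - 𝐞 (-(j * v ^ 2))) := by
      module
    have hdist : |-(j * v ^ 2 + s * v ^ 3) - -(j * v ^ 2)| = s * |v| ^ 3 := by
      rw [show -(j * v ^ 2 + s * v ^ 3) - -(j * v ^ 2) = -(s * v ^ 3) by ring, abs_neg, abs_mul,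
        abs_of_pos hs, abs_pow]
    have hchar := norm_fourierChar_sub_le (-(j * v ^ 2 + s * v ^ 3)) (-(j * v ^ 2))
    rw [hdist] at hchar
    rw [hsplit]
    refine (norm_add_le _ _).trans ?_
    rw [norm_smul, norm_smul, Circle.norm_coe, Real.norm_of_nonneg (by positivity : 0 ≤ 2 * w),
      Real.norm_eq_abs, abs_mul, abs_two, mul_one]
    calc _ ≤ 2 * h + 2 * w * (2 * π * (s * h ^ 3)) := by
          gcongr
          exact hchar.trans (by gcongr)
      _ = 2 * h + 4 * π * w * s * h ^ 3 := by ring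
  rw [← intervalIntegral.integral_smul, ← intervalIntegral.integral_sub
    (Continuous.intervalIntegrable (by fun_prop) _ _)
    (Continuous.intervalIntegrable (by fun_prop) _ _)]
  refine (intervalIntegral.norm_integral_le_of_norm_le_const hpoint).trans_eq ?_
  rw [abs_of_nonneg (by linarith)]
  linear_combination 8 / 3 * π * h ^ 4 * hsw

/-- The constant `c` for which the terms around the stationary point `j` contribute
`c √j exp (2πi t j ^ 3)`, `t = 4 / (27 s ^ 2)`, to leading order. -/
noncomputable def stationaryCoeff (s : ℝ) : ℂ :=
  (4 / (3 * s)) • (1 / (2 * Complex.I)) ^ (1 / 2 : ℂ)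

theorem norm_sum_window_sub_le (hs : 0 < s) (hj : 0 < j) (hh : 0 < h)
    (hw : h ≤ stationaryRoot s j) :
    ‖∑ k ∈ Ioc ⌊(stationaryRoot s j - h) ^ 2⌋₊ ⌊(stationaryRoot s j + h) ^ 2⌋₊,
        (𝐞 (-(s * (k : ℝ) ^ (3 / 2 : ℝ))) : ℂ)
      - √j • (stationaryCoeff s * 𝐞 (4 / 27 * (s ^ 2)⁻¹ * (j : ℝ) ^ 3))‖
      ≤ 2 + 8 * π * j * h ^ 2 + (4 * h ^ 2 + 16 / 3 * π * j * h ^ 4) + 4 / (3 * s * h) := by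
  have hj' : (0 : ℝ) < j := Nat.cast_pos.mpr hj
  have hw0 : 0 ≤ stationaryRoot s j := hh.le.trans hw
  have hsum := norm_sum_window_sub_integral_le hs hh.le hw
  have hchirp := norm_integral_chirp_sub_le (j := j) hs hh.le
  have hfresnel : ‖(2 * stationaryRoot s j) • ((√j)⁻¹ • (1 / (2 * Complex.I)) ^ (1 / 2 : ℂ)
      - ∫ v in -h..h, (𝐞 (-(j * v ^ 2)) : ℂ))‖ ≤ 4 / (3 * s * h) := by
    rw [norm_smul, Real.norm_of_nonneg (by positivity)]
    calc _ ≤ 2 * stationaryRoot s j * (1 / (j * h)) := by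
          gcongr
          exact norm_fresnel_smul_sub_integral_le hj' hh
      _ = 4 / (3 * s * h) := by
          unfold stationaryRoot
          field_simp
          norm_num
  have hcoeff : √j • stationaryCoeff s
      = (2 * stationaryRoot s j) • ((√j)⁻¹ • (1 / (2 * Complex.I)) ^ (1 / 2 : ℂ)) := by
    rw [stationaryCoeff, smul_smul, smul_smul, stationaryRoot]
    congr 1
    field_simp
    rw [Real.sq_sqrt hj'.le]
    ring
  rw [integral_window_eq hs hh.le hw] at hsum
  rw [← smul_mul_assoc, hcoeff]
  rw [← one_mul ‖_ - _‖, ← Circle.norm_coe (𝐞 (4 / 27 * (s ^ 2)⁻¹ * (j : ℝ) ^ 3)),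
    ← norm_mul] at hchirp
  rw [← one_mul ‖_ • _‖, ← Circle.norm_coe (𝐞 (4 / 27 * (s ^ 2)⁻¹ * (j : ℝ) ^ 3)),
    ← norm_mul] at hfresnel
  refine le_trans (le_of_eq ?_) ((norm_sub_le _ _).trans
    (add_le_add ((norm_add_le _ _).trans (add_le_add hsum hchirp)) hfresnel))
  congr 1
  rw [smul_sub]
  ring

theorem norm_sum_gap_le (hs : 0 < s) {h' : ℝ} (hh' : h' ≤ h) (hh0 : 0 < h')
    (hw : 3 / 2 * s * h' ≤ 1) :
    ‖∑ k ∈ Ioc ⌊(stationaryRoot s j + h) ^ 2⌋₊ ⌊(stationaryRoot s (j + 1) - h') ^ 2⌋₊,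
        (𝐞 (-(s * (k : ℝ) ^ (3 / 2 : ℝ))) : ℂ)‖ ≤ 2 / (3 * s * h') := by
  have hroot (i : ℕ) : 3 * s * stationaryRoot s i = 2 * i := three_mul_mul_stationaryRoot hs.ne'
  have hflip : ∀ k : ℕ, (𝐞 (-(s * (k : ℝ) ^ (3 / 2 : ℝ))) : ℂ)
      = conj (𝐞 (s * (k : ℝ) ^ (3 / 2 : ℝ) - j * k) : ℂ) := fun k => by
    rw [Circle.starRingEnd_addChar, neg_sub, fourierChar_natCast_mul_sub]
  have hbound := norm_sum_Ioc_floor_fourierChar_le (δ := 3 / 2 * s * h')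
    (a := (stationaryRoot s j + h) ^ 2) (b := (stationaryRoot s (j + 1) - h') ^ 2)
    (f := fun x => s * x ^ (3 / 2 : ℝ) - j * x) (f' := fun x => s * (3 / 2 * √x) - j)
    (by positivity) hw (fun x _ => ?_) (fun x _ y _ hxy => ?_) fun x hx => ?_
  · simp only [hflip, ← map_sum, RCLike.norm_conj]
    refine hbound.trans_eq ?_
    field_simp
  · simpa using ((hasDerivAt_rpow_three_halves x).const_mul s).fun_sub
      ((hasDerivAt_id x).const_mul (j : ℝ))
  · dsimp only
    gcongr
  · have hstep : h' ≤ stationaryRoot s (j + 1) := by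
      have := hroot (j + 1)
      push_cast at this
      nlinarith [(Nat.cast_nonneg j : (0 : ℝ) ≤ j)]
    have hlo : stationaryRoot s j + h ≤ √x := Real.le_sqrt_of_sq_le hx.1
    have hhi : √x ≤ stationaryRoot s (j + 1) - h' :=
      Real.sqrt_le_iff.mpr ⟨sub_nonneg.mpr hstep, hx.2⟩
    have hj := hroot j
    have hj' := hroot (j + 1)
    push_cast at hj'
    constructor <;> nlinarith

/-- The radius, in the variable `√x`, of the window on which the sum is compared with its
stationary phase integral. The exponent balances the error made on the windows against that made
between them. -/
noncomputable def windowRadius (j : ℕ) : ℝ :=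
  ((j : ℝ) ^ (3 : ℝ)⁻¹)⁻¹

theorem windowRadius_pos (hj : 0 < j) : 0 < windowRadius j := by
  unfold windowRadius
  positivity

theorem tendsto_windowRadius : Tendsto windowRadius atTop (𝓝 0) :=
  ((tendsto_rpow_atTop (by norm_num)).comp tendsto_natCast_atTop_atTop).inv_tendsto_atTop

theorem windowRadius_succ_le (hj : 0 < j) : windowRadius (j + 1) ≤ windowRadius j := by
  unfold windowRadius
  gcongr
  exact j.le_succ

theorem tendsto_stationaryRoot (hs : 0 < s) : Tendsto (stationaryRoot s) atTop atTop :=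
  (tendsto_natCast_atTop_atTop.const_mul_atTop two_pos).atTop_div_const (by positivity)

theorem isBigO_sum_window_sub (hs : 0 < s) :
    (fun j => ∑ k ∈ Ioc ⌊(stationaryRoot s j - windowRadius j) ^ 2⌋₊
        ⌊(stationaryRoot s j + windowRadius j) ^ 2⌋₊, (𝐞 (-(s * (k : ℝ) ^ (3 / 2 : ℝ))) : ℂ)
      - √j • (stationaryCoeff s * 𝐞 (4 / 27 * (s ^ 2)⁻¹ * (j : ℝ) ^ 3)))
      =O[atTop] fun j : ℕ => (j : ℝ) ^ (3 : ℝ)⁻¹ := by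
  refine IsBigO.of_bound (2 + 8 * π + (4 + 16 / 3 * π) + 4 / (3 * s)) ?_
  filter_upwards [eventually_gt_atTop 0, (tendsto_stationaryRoot hs).eventually_ge_atTop 1,
    tendsto_windowRadius.eventually_le_const one_pos] with j hj hw hr
  refine (norm_sum_window_sub_le hs hj (windowRadius_pos hj) (hr.trans hw)).trans ?_
  have hq : (1 : ℝ) ≤ (j : ℝ) ^ (3 : ℝ)⁻¹ :=
    Real.one_le_rpow (by exact_mod_cast hj) (by norm_num)
  have hj3 : (j : ℝ) = ((j : ℝ) ^ (3 : ℝ)⁻¹) ^ 3 :=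
    (Real.rpow_inv_natCast_pow j.cast_nonneg three_ne_zero).symm
  rw [Real.norm_of_nonneg (by positivity)]
  unfold windowRadius
  set q := (j : ℝ) ^ (3 : ℝ)⁻¹
  have hq' : q⁻¹ ≤ q := (inv_le_one_of_one_le₀ hq).trans hq
  have hq2 : q⁻¹ ^ 2 ≤ q := (pow_le_of_le_one (by positivity) (inv_le_one_of_one_le₀ hq)
    two_ne_zero).trans hq'
  calc _ = 2 * 1 + 8 * π * q + (4 * q⁻¹ ^ 2 + 16 / 3 * π * q⁻¹) + 4 / (3 * s) * q := by
        rw [hj3]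
        field_simp
    _ ≤ 2 * q + 8 * π * q + (4 * q + 16 / 3 * π * q) + 4 / (3 * s) * q := by gcongr
    _ = _ := by ring

theorem isBigO_sum_gap (hs : 0 < s) :
    (fun j => ∑ k ∈ Ioc ⌊(stationaryRoot s j + windowRadius j) ^ 2⌋₊
        ⌊(stationaryRoot s (j + 1) - windowRadius (j + 1)) ^ 2⌋₊,
        (𝐞 (-(s * (k : ℝ) ^ (3 / 2 : ℝ))) : ℂ))
      =O[atTop] fun j : ℕ => (j : ℝ) ^ (3 : ℝ)⁻¹ := by
  have hsucc := tendsto_windowRadius.comp (tendsto_add_atTop_nat 1)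
  refine IsBigO.of_bound (2 / (3 * s) * 2) ?_
  have hpos : 0 < 2 / (3 * s) := by positivity
  filter_upwards [eventually_gt_atTop 0, hsucc.eventually_le_const hpos] with j hj hr
  refine (norm_sum_gap_le hs (windowRadius_succ_le hj)
    (windowRadius_pos j.succ_pos) ?_).trans ?_
  · calc _ ≤ 3 / 2 * s * (2 / (3 * s)) := by
          gcongr
          exact hr
      _ = 1 := by field_simp
  · have hj1 : ((j + 1 : ℕ) : ℝ) ^ (3 : ℝ)⁻¹ ≤ 2 * (j : ℝ) ^ (3 : ℝ)⁻¹ := by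
      refine (Real.rpow_le_rpow (by positivity) (y := 2 * (j : ℝ)) ?_ (by positivity)).trans ?_
      · have : (1 : ℝ) ≤ j := by exact_mod_cast hj
        push_cast
        linarith
      · rw [Real.mul_rpow zero_le_two j.cast_nonneg]
        gcongr
        exact Real.rpow_le_self_of_one_le one_le_two (by norm_num)
    rw [Real.norm_of_nonneg (by positivity), windowRadius]
    calc _ = 2 / (3 * s) * ((j + 1 : ℕ) : ℝ) ^ (3 : ℝ)⁻¹ := by field_simp
      _ ≤ 2 / (3 * s) * (2 * (j : ℝ) ^ (3 : ℝ)⁻¹) := by gcongr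
      _ = _ := by ring

/-- The left end of the window around the `j`-th stationary point. -/
noncomputable def windowStart (s : ℝ) (j : ℕ) : ℕ :=
  ⌊(stationaryRoot s j - windowRadius j) ^ 2⌋₊

theorem isBigO_sum_block_sub (hs : 0 < s) :
    (fun j => ∑ k ∈ range (windowStart s (j + 1) + 1), (𝐞 (-(s * (k : ℝ) ^ (3 / 2 : ℝ))) : ℂ)
      - ∑ k ∈ range (windowStart s j + 1), (𝐞 (-(s * (k : ℝ) ^ (3 / 2 : ℝ))) : ℂ)
      - √j • (stationaryCoeff s * 𝐞 (4 / 27 * (s ^ 2)⁻¹ * (j : ℝ) ^ 3)))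
      =O[atTop] fun j : ℕ => (j : ℝ) ^ (3 : ℝ)⁻¹ := by
  refine ((isBigO_sum_window_sub hs).add (isBigO_sum_gap hs)).congr' ?_ .rfl
  have hsum := tendsto_windowRadius.add (tendsto_windowRadius.comp (tendsto_add_atTop_nat 1))
  have hlim : (0 : ℝ) + 0 < 2 / (3 * s) := by
    rw [add_zero]
    positivity
  filter_upwards [eventually_gt_atTop 0, (tendsto_stationaryRoot hs).eventually_ge_atTop 1,
    tendsto_windowRadius.eventually_le_const one_pos,
    hsum.eventually_le_const hlim] with j hj hw hr hgap
  have hpos := windowRadius_pos hj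
  have hstep : stationaryRoot s (j + 1) = stationaryRoot s j + 2 / (3 * s) := by
    unfold stationaryRoot
    push_cast
    ring
  have hwindow : windowStart s j ≤ ⌊(stationaryRoot s j + windowRadius j) ^ 2⌋₊ := by
    unfold windowStart
    gcongr <;> linarith
  have hgap' : ⌊(stationaryRoot s j + windowRadius j) ^ 2⌋₊ ≤ windowStart s (j + 1) := by
    unfold windowStart
    simp only [Function.comp_apply] at hgap
    gcongr
    linarith
  rw [← sum_Ico_eq_sub _ (by omega), Ico_add_one_add_one_eq_Ioc,
    ← sum_Ioc_consecutive _ hwindow hgap']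
  unfold windowStart
  ring

theorem tendsto_sum_range_windowStart (hs : 0 < s) {μ : ℂ}
    (hμ : HasMean (fun j : ℕ => (𝐞 (4 / 27 * (s ^ 2)⁻¹ * (j : ℝ) ^ 3) : ℂ)) μ) :
    Tendsto (fun j : ℕ => ((j : ℝ) ^ (3 / 2 : ℝ))⁻¹ •
        ∑ k ∈ range (windowStart s j + 1), (𝐞 (-(s * (k : ℝ) ^ (3 / 2 : ℝ))) : ℂ)) atTop
      (𝓝 ((2 / 3 : ℝ) • (stationaryCoeff s * μ))) := by
  let P (j : ℕ) : ℂ :=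
    ∑ k ∈ range (windowStart s j + 1), (𝐞 (-(s * (k : ℝ) ^ (3 / 2 : ℝ))) : ℂ)
  have hsmall : (fun j : ℕ => (j : ℝ) ^ (3 : ℝ)⁻¹) =o[atTop] fun j : ℕ => (j : ℝ) ^ (1 / 2 : ℝ) :=
    (isLittleO_rpow_rpow_atTop (by norm_num)).comp_tendsto tendsto_natCast_atTop_atTop
  have hblock := (isBigO_sum_block_sub hs).trans_isLittleO hsmall
  simp only [Real.sqrt_eq_rpow] at hblock
  have hmain := (hμ.const_mul (stationaryCoeff s)).tendsto_sum_of_sub_isLittleO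
    (b := fun j => P (j + 1) - P j) one_half_pos hblock
  simp only [sum_range_sub P] at hmain
  have hinit : Tendsto (fun j : ℕ => ((j : ℝ) ^ (3 / 2 : ℝ))⁻¹ • P 0) atTop (𝓝 0) := by
    simpa using ((tendsto_rpow_atTop (by norm_num)).comp
      tendsto_natCast_atTop_atTop).inv_tendsto_atTop.smul_const (P 0)
  rw [show (1 / 2 + 1 : ℝ) = 3 / 2 by norm_num, inv_div] at hmain
  simpa only [← smul_add, sub_add_cancel, add_zero] using hmain.add hinit

theorem tendsto_natCast_sqrt_atTop : Tendsto (fun N : ℕ => √(N : ℝ)) atTop atTop :=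
  Real.tendsto_sqrt_atTop.comp tendsto_natCast_atTop_atTop

theorem stationaryRoot_floor_le (hs : 0 < s) {r : ℝ} (hr : 0 ≤ r) :
    stationaryRoot s ⌊3 * s / 2 * r⌋₊ ≤ r := by
  rw [stationaryRoot, div_le_iff₀ (by positivity)]
  linarith [Nat.floor_le (a := 3 * s / 2 * r) (by positivity)]

theorem le_stationaryRoot_floor_add (hs : 0 < s) (r : ℝ) :
    r ≤ stationaryRoot s ⌊3 * s / 2 * r⌋₊ + 2 / (3 * s) := by
  rw [stationaryRoot, ← add_div, le_div_iff₀ (by positivity)]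
  linarith [Nat.lt_floor_add_one (3 * s / 2 * r)]

theorem isBigO_windowStart_sub (hs : 0 < s) :
    (fun N : ℕ => ((windowStart s ⌊3 * s / 2 * √N⌋₊ + 1 : ℕ) : ℝ) - N)
      =O[atTop] fun N : ℕ => √(N : ℝ) := by
  set c := 2 / (3 * s) + 1
  have hc0 : 0 < c := by positivity
  have hindex : Tendsto (fun N : ℕ => ⌊3 * s / 2 * √N⌋₊) atTop atTop :=
    tendsto_nat_floor_atTop.comp (tendsto_natCast_sqrt_atTop.const_mul_atTop (by positivity))
  refine IsBigO.of_bound (2 * c + 1) ?_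
  filter_upwards [hindex.eventually_gt_atTop 0,
    (tendsto_windowRadius.comp hindex).eventually_le_const one_pos,
    tendsto_natCast_sqrt_atTop.eventually_ge_atTop (c + 1)] with N hN hradius hsqrt
  have hupper := stationaryRoot_floor_le hs (Real.sqrt_nonneg N)
  have hlower := le_stationaryRoot_floor_add hs √N
  have hpos := windowRadius_pos hN
  have hNsq : √(N : ℝ) ^ 2 = N := Real.sq_sqrt N.cast_nonneg
  unfold windowStart
  simp only [Function.comp_apply] at hradius
  set d := stationaryRoot s ⌊3 * s / 2 * √N⌋₊ - windowRadius ⌊3 * s / 2 * √N⌋₊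
  have hd : √N - c ≤ d := by linarith
  have hd0 : 0 ≤ √N - c := by linarith
  have hsq : (√N - c) ^ 2 ≤ d ^ 2 := pow_le_pow_left₀ hd0 hd 2
  have hsq' : d ^ 2 ≤ √N ^ 2 := pow_le_pow_left₀ (hd0.trans hd) (by linarith) 2
  have hfloor := Nat.floor_le (sq_nonneg d)
  have hfloor' := Nat.lt_floor_add_one (d ^ 2)
  rw [Real.norm_eq_abs, Real.norm_of_nonneg (Real.sqrt_nonneg _), abs_le]
  push_cast
  constructor <;> linarith [sq_nonneg c]

theorem tendsto_sum_fourierChar_rpow_three_halves (hs : 0 < s) {μ : ℂ}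
    (hμ : HasMean (fun j : ℕ => (𝐞 (4 / 27 * (s ^ 2)⁻¹ * (j : ℝ) ^ 3) : ℂ)) μ) :
    Tendsto (fun N : ℕ => ((N : ℝ) ^ (3 / 4 : ℝ))⁻¹ •
        ∑ k ∈ range N, (𝐞 (-(s * (k : ℝ) ^ (3 / 2 : ℝ))) : ℂ)) atTop
      (𝓝 ((3 * s / 2) ^ (3 / 2 : ℝ) • (2 / 3 : ℝ) • (stationaryCoeff s * μ))) := by
  let S (n : ℕ) : ℂ := ∑ k ∈ range n, (𝐞 (-(s * (k : ℝ) ^ (3 / 2 : ℝ))) : ℂ)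
  let J (N : ℕ) : ℕ := ⌊3 * s / 2 * √N⌋₊
  have hJ : Tendsto J atTop atTop :=
    tendsto_nat_floor_atTop.comp (tendsto_natCast_sqrt_atTop.const_mul_atTop (by positivity))
  have hpow (N : ℕ) (p : ℝ) : √(N : ℝ) ^ p = (N : ℝ) ^ (p / 2) := by
    rw [Real.sqrt_eq_rpow, ← Real.rpow_mul N.cast_nonneg, one_div_mul_eq_div]
  have hratio : Tendsto (fun N : ℕ => ((J N : ℝ) / √N) ^ (3 / 2 : ℝ)) atTop
      (𝓝 ((3 * s / 2) ^ (3 / 2 : ℝ))) :=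
    ((tendsto_nat_floor_mul_div_atTop (by positivity)).comp
      tendsto_natCast_sqrt_atTop).rpow_const (.inr (by norm_num))
  have hmain := hratio.smul ((tendsto_sum_range_windowStart hs hμ).comp hJ)
  have hdiff : (fun N => S (windowStart s (J N) + 1) - S N) =O[atTop] fun N : ℕ => √(N : ℝ) :=
    (IsBigO.of_bound' (Eventually.of_forall fun N =>
      norm_sum_range_sub_sum_range_le (fun k => (Circle.norm_coe _).le) _ _)).trans
      (isBigO_windowStart_sub hs)
  have hsmall : (fun N : ℕ => √(N : ℝ)) =o[atTop] fun N : ℕ => (N : ℝ) ^ (3 / 4 : ℝ) := by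
    simpa only [Real.sqrt_eq_rpow, Function.comp_def] using
      (isLittleO_rpow_rpow_atTop (by norm_num)).comp_tendsto tendsto_natCast_atTop_atTop
  have hrem := (hdiff.trans_isLittleO hsmall).tendsto_inv_smul_nhds_zero
  rw [← sub_zero (_ • _ • _)]
  refine (hmain.sub hrem).congr' ?_
  filter_upwards [hJ.eventually_gt_atTop 0] with N hN
  have hN' : (0 : ℝ) < J N := Nat.cast_pos.mpr hN
  have hcancel : ((J N : ℝ) / √N) ^ (3 / 2 : ℝ) * ((J N : ℝ) ^ (3 / 2 : ℝ))⁻¹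
      = ((N : ℝ) ^ (3 / 4 : ℝ))⁻¹ := by
    rw [Real.div_rpow hN'.le (Real.sqrt_nonneg _), hpow, div_mul_eq_mul_div,
      mul_inv_cancel₀ (by positivity), one_div]
    norm_num
  rw [Function.comp_apply, smul_smul, hcancel, ← smul_sub, sub_sub_cancel]

end StationaryPhase

section Profile

variable {b d s : ℝ} {L : ℂ}

theorem powerDirichlet_eq_tsum (b x s : ℝ) :
    powerDirichlet b (x + 2 * π * Complex.I * s)
      = ∑' k : ℕ, Real.exp (-(x * (k : ℝ) ^ b)) • (𝐞 (-(s * (k : ℝ) ^ b)) : ℂ) := by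
  refine tsum_congr fun k => ?_
  rw [Real.fourierChar_apply, Complex.real_smul, Complex.ofReal_exp, ← Complex.exp_add]
  congr 1
  push_cast
  ring

theorem norm_cexp_neg_mul_ofReal (z : ℂ) (r : ℝ) :
    ‖Complex.exp (-z * r)‖ = Real.exp (-(z.re * r)) := by
  rw [Complex.norm_exp, Complex.re_mul_ofReal, Complex.neg_re, neg_mul]

theorem hasProfile_of_tendsto {α : ℝ} (hb : 1 ≤ b) (hα : 0 < α) (hd : 1 / d = α / b) {C : ℂ}
    (h : Tendsto (fun N : ℕ => ((N : ℝ) ^ α)⁻¹ •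
      ∑ k ∈ range N, (𝐞 (-(s * (k : ℝ) ^ b)) : ℂ)) atTop (𝓝 C)) :
    HasProfile b d s (Real.Gamma (1 + 1 / d) * C) := by
  have hsummable (x : ℝ) (hx : 0 < x) : Summable fun k : ℕ =>
      Real.exp (-(x * (k : ℝ) ^ b)) * ‖(𝐞 (-(s * (k : ℝ) ^ b)) : ℂ)‖ := by
    simpa only [norm_cexp_neg_mul_ofReal, Complex.ofReal_re, Circle.norm_coe, mul_one]
      using powerDirichlet_summable b hb x (by simpa using hx)
  have habel := tendsto_rpow_smul_tsum_exp_neg (one_pos.trans_le hb) hα hsummable h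
  simpa only [HasProfile, powerDirichlet_eq_tsum, hd, ← Complex.real_smul] using habel

theorem hasProfile_of_hasMean (hb : 1 ≤ b) {c : ℂ}
    (h : HasMean (fun k : ℕ => (𝐞 (-(s * (k : ℝ) ^ b)) : ℂ)) c) :
    HasProfile b b s (Real.Gamma (1 + 1 / b) * c) :=
  hasProfile_of_tendsto hb one_pos rfl (by simpa only [HasMean, Real.rpow_one] using h)

theorem HasProfile.unique {L' : ℂ} (h : HasProfile b d s L) (h' : HasProfile b d s L') : L = L' :=
  tendsto_nhds_unique h h'

theorem powerDirichlet_conj (b : ℝ) (z : ℂ) :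
    powerDirichlet b (conj z) = conj (powerDirichlet b z) := by
  unfold powerDirichlet dirichletSeries
  rw [Complex.conj_tsum]
  refine tsum_congr fun k => ?_
  rw [← Complex.exp_conj, map_mul, map_neg, Complex.conj_ofReal]

theorem HasProfile.neg (h : HasProfile b d s L) : HasProfile b d (-s) (conj L) := by
  refine ((Complex.continuous_conj.tendsto L).comp h).congr fun x => ?_
  rw [Function.comp_apply, map_mul, Complex.conj_ofReal, ← powerDirichlet_conj]
  congr 2
  simp [map_ofNat]

theorem HasProfile.isBigO (h : HasProfile b d s L) :
    (fun x : ℝ => powerDirichlet b (x + 2 * π * Complex.I * s))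
      =O[𝓝[>] 0] fun x : ℝ => x ^ (-(1 / d)) := by
  refine ((isBigO_refl (fun x : ℝ => x ^ (-(1 / d))) (𝓝[>] 0)).smul
    (Tendsto.isBigO_one ℝ h)).congr' ?_ (by simp)
  filter_upwards [self_mem_nhdsWithin] with x (hx : 0 < x)
  rw [← Complex.real_smul, Real.rpow_neg hx.le, inv_smul_smul₀ (by positivity)]

theorem tendsto_rpow_mul_powerDirichlet (hb : 1 ≤ b) :
    Tendsto (fun x : ℝ => ((x ^ (1 / b) : ℝ) : ℂ) * powerDirichlet b x) (𝓝[>] 0)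
      (𝓝 (Real.Gamma (1 + 1 / b))) := by
  simpa [HasProfile] using hasProfile_of_hasMean hb (s := 0) (c := 1)
    (by simpa using HasMean.const (1 : ℂ))

theorem norm_powerDirichlet_le (hb : 1 ≤ b) {z : ℂ} (hz : 0 < z.re) :
    ‖powerDirichlet b z‖ ≤ ‖powerDirichlet b z.re‖ := by
  have hre : powerDirichlet b z.re = ((∑' k : ℕ, Real.exp (-(z.re * (k : ℝ) ^ b)) : ℝ) : ℂ) := by
    simp [powerDirichlet, dirichletSeries, Complex.ofReal_tsum]
  rw [hre, Complex.norm_real]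
  refine (norm_tsum_le_tsum_norm (powerDirichlet_summable b hb z hz)).trans ?_
  simp only [norm_cexp_neg_mul_ofReal]
  exact le_abs_self _

theorem exists_forall_rpow_mul_norm_powerDirichlet_lt (hb : 1 ≤ b) :
    ∃ M : ℝ, ∀ᶠ x : ℝ in 𝓝[>] 0, ∀ y : ℝ,
      x ^ (1 / b) * ‖powerDirichlet b (x + Complex.I * y)‖ < M := by
  obtain ⟨M, hM⟩ := exists_gt ‖(Real.Gamma (1 + 1 / b) : ℂ)‖
  refine ⟨M, ?_⟩
  filter_upwards [(tendsto_rpow_mul_powerDirichlet hb).norm.eventually_lt_const hM,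
    self_mem_nhdsWithin] with x hx (hx0 : 0 < x) y
  refine lt_of_le_of_lt ?_ hx
  rw [norm_mul, Complex.norm_real, Real.norm_of_nonneg (by positivity)]
  gcongr
  simpa using norm_powerDirichlet_le hb (z := x + Complex.I * y) (by simpa using hx0)

end Profile

section PowerMean

variable {t : ℝ} {n : ℕ} {p : ℤ}

theorem ae_irrational : ∀ᵐ t : ℝ, Irrational t :=
  (Set.countable_range ((↑) : ℚ → ℝ)).ae_notMem volume

theorem fourierChar_mul_intCast_eq_one (ht : t * n = p) {q : ℤ} (hq : (n : ℤ) ∣ q) :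
    𝐞 (t * q) = 1 := by
  obtain ⟨c, rfl⟩ := hq
  refine fourierChar_eq_one_iff.mpr ⟨p * c, ?_⟩
  push_cast
  rw [← mul_assoc, ht]

theorem periodic_fourierChar_mul_pow (ht : t * n = p) (b : ℕ) :
    Function.Periodic (fun k : ℕ => (𝐞 (t * (k : ℝ) ^ b) : ℂ)) n := fun k => by
  have hdvd : (n : ℤ) ∣ (k + n) ^ b - k ^ b := by
    simpa using sub_dvd_pow_sub_pow ((k : ℤ) + n) k b
  have hsplit : t * ((k + n : ℕ) : ℝ) ^ b
      = t * (((k + n) ^ b - k ^ b : ℤ) : ℝ) + t * (k : ℝ) ^ b := by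
    push_cast
    ring
  simp only [hsplit, AddChar.map_add_eq_mul, fourierChar_mul_intCast_eq_one ht hdvd, one_mul]

theorem fourierChar_mul_sub_pow (ht : t * n = p) {b k : ℕ} (hb : Odd b) (hk : k ≤ n) :
    (𝐞 (t * ((n - k : ℕ) : ℝ) ^ b) : ℂ) = conj (𝐞 (t * (k : ℝ) ^ b) : ℂ) := by
  have hdvd : (n : ℤ) ∣ (n - k) ^ b + k ^ b := by
    simpa using hb.add_dvd_pow_add_pow ((n : ℤ) - k) k
  have hsplit : t * ((n - k : ℕ) : ℝ) ^ b
      = t * (((n - k) ^ b + k ^ b : ℤ) : ℝ) + -(t * (k : ℝ) ^ b) := by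
    push_cast [hk]
    ring
  rw [hsplit, AddChar.map_add_eq_mul, fourierChar_mul_intCast_eq_one ht hdvd, one_mul,
    Circle.starRingEnd_addChar]

theorem conj_sum_range_fourierChar_mul_pow (ht : t * n = p) {b : ℕ} (hb : Odd b) :
    conj (∑ k ∈ range n, (𝐞 (t * (k : ℝ) ^ b) : ℂ))
      = ∑ k ∈ range n, (𝐞 (t * (k : ℝ) ^ b) : ℂ) := by
  have hend : conj (𝐞 (t * (n : ℝ) ^ b) : ℂ) = 𝐞 (t * (n : ℝ) ^ b) := by
    have hn : (𝐞 (t * ((0 + n : ℕ) : ℝ) ^ b) : ℂ) = 𝐞 (t * ((0 : ℕ) : ℝ) ^ b) :=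
      periodic_fourierChar_mul_pow ht b 0
    rw [zero_add] at hn
    simp [hn, hb.pos.ne']
  have hflip := sum_flip (n := n) fun k => (𝐞 (t * (k : ℝ) ^ b) : ℂ)
  rw [sum_congr rfl fun k hk => fourierChar_mul_sub_pow ht hb (mem_range_succ_iff.mp hk),
    ← map_sum, sum_range_succ, map_add, hend] at hflip
  exact add_right_cancel hflip

theorem exists_hasMean_ofReal_of_odd (t : ℝ) {b : ℕ} (hb : Odd b) :
    ∃ μ : ℝ, HasMean (fun k : ℕ => (𝐞 (t * (k : ℝ) ^ b) : ℂ)) μ := by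
  by_cases ht : Irrational t
  · exact ⟨0, by simpa using hasMean_fourierChar_mul_pow ht hb.pos⟩
  · obtain ⟨q, rfl⟩ : ∃ q : ℚ, (q : ℝ) = t := by simpa [Irrational] using ht
    have hq : (q : ℝ) * q.den = q.num := mod_cast q.mul_den_eq_num
    obtain ⟨r, hr⟩ := Complex.conj_eq_iff_real.mp (conj_sum_range_fourierChar_mul_pow hq hb)
    have hmean := HasMean.of_periodic q.den_pos (periodic_fourierChar_mul_pow hq b)
    rw [hr, Complex.real_smul, ← Complex.ofReal_mul] at hmean
    exact ⟨_, hmean⟩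

theorem HasMean.fourierChar_neg {f : ℕ → ℝ} {c : ℂ} (h : HasMean (fun k => (𝐞 (f k) : ℂ)) c) :
    HasMean (fun k => (𝐞 (-f k) : ℂ)) (conj c) := by
  simpa only [Circle.starRingEnd_addChar] using h.conj

theorem sum_Icc_one_eq_sum_range {M : Type*} [AddCancelCommMonoid M] {a : ℕ → M}
    (h : a n = a 0) : ∑ l ∈ Icc 1 n, a l = ∑ k ∈ range n, a k := by
  have hshift : ∑ l ∈ Icc 1 n, a l = ∑ k ∈ range n, a (k + 1) := by
    rw [range_eq_Ico, sum_Ico_add' a 0 n 1, zero_add, Ico_add_one_right_eq_Icc]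
  rw [hshift, ← add_left_inj (a 0), ← sum_range_succ', sum_range_succ, h]

theorem hasMean_expMean (b m : ℕ) (hn : 1 ≤ n) :
    HasMean (fun k : ℕ => (𝐞 (-((m : ℝ) / n * (k : ℝ) ^ b)) : ℂ)) (expMean b m n) := by
  have ht : -((m : ℝ) / n) * n = (-m : ℤ) := by
    push_cast
    field_simp
  have hper := periodic_fourierChar_mul_pow ht b
  have hmean : (n : ℝ)⁻¹ • ∑ k ∈ range n, (𝐞 (-((m : ℝ) / n) * (k : ℝ) ^ b) : ℂ)
      = expMean b m n := by
    rw [← sum_Icc_one_eq_sum_range (by simpa using hper 0), expMean, Complex.real_smul,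
      Complex.ofReal_inv, Complex.ofReal_natCast, ← one_div]
    refine congrArg _ (sum_congr rfl fun l _ => ?_)
    rw [Real.fourierChar_apply]
    congr 1
    push_cast
    ring
  rw [← hmean]
  simpa only [neg_mul] using HasMean.of_periodic hn hper

theorem hasProfile_natCast_div {b : ℕ} (hb : 1 ≤ b) (m : ℕ) (hn : 1 ≤ n) :
    HasProfile b b (m / n) (Real.Gamma (1 + 1 / (b : ℝ)) * expMean b m n) :=
  hasProfile_of_hasMean (mod_cast hb)
    (by simpa only [Real.rpow_natCast] using hasMean_expMean b m hn)

theorem ae_hasProfile_zero {b : ℕ} (hb : 1 ≤ b) : ∀ᵐ s : ℝ, HasProfile b b s 0 := by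
  filter_upwards [ae_irrational] with s hs
  simpa using hasProfile_of_hasMean (b := b) (c := 0) (mod_cast hb)
    (by simpa using hasMean_fourierChar_mul_pow hs.neg hb)

end PowerMean

section ThreeHalves

variable {s μ : ℝ}

theorem hasProfile_three_of_hasMean {t μ : ℝ}
    (h : HasMean (fun j : ℕ => (𝐞 (t * (j : ℝ) ^ 3) : ℂ)) μ) :
    HasProfile 3 3 t (Real.Gamma (4 / 3) * μ) := by
  have hneg : HasMean (fun j : ℕ => (𝐞 (-(t * (j : ℝ) ^ (3 : ℝ))) : ℂ)) μ := by
    simpa using h.fourierChar_neg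
  have hprofile := hasProfile_of_hasMean (by norm_num) hneg
  norm_num at hprofile ⊢
  exact hprofile

theorem ofReal_mul_cpow_half {a : ℝ} (ha : 0 < a) (z : ℂ) :
    (a * z) ^ (1 / 2 : ℂ) = √a * z ^ (1 / 2 : ℂ) := by
  rcases eq_or_ne z 0 with rfl | hz
  · simp
  have ha' : (a : ℂ) ≠ 0 := mod_cast ha.ne'
  rw [Real.sqrt_eq_rpow, Complex.ofReal_cpow ha.le, Complex.cpow_def_of_ne_zero (by positivity),
    Complex.cpow_def_of_ne_zero hz, Complex.cpow_def_of_ne_zero ha', Complex.log_ofReal_mul ha hz,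
    add_mul, Complex.exp_add, Complex.ofReal_log ha.le]
  norm_num

theorem conj_ofReal_mul_I_cpow_half (a : ℝ) :
    conj ((a * Complex.I) ^ (1 / 2 : ℂ)) = ((-a : ℝ) * Complex.I) ^ (1 / 2 : ℂ) := by
  have harg : (a * Complex.I).arg ≠ π := by
    rw [Ne, Complex.arg_eq_pi_iff]
    simp
  have hhalf : conj (1 / 2 : ℂ) = 1 / 2 := by simp [map_ofNat]
  have hconj := Complex.conj_cpow (a * Complex.I) (1 / 2) harg
  rw [hhalf] at hconj
  rw [← hconj]
  simp

theorem Gamma_smul_stationaryCoeff (hs : 0 < s) :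
    Real.Gamma (1 + 1 / 2) • (3 * s / 2) ^ (3 / 2 : ℝ) • (2 / 3 : ℝ) • stationaryCoeff s
      = (π * s / (3 * Complex.I)) ^ (1 / 2 : ℂ) := by
  have hGamma : Real.Gamma (1 + 1 / 2) = √π / 2 := by
    rw [add_comm, Real.Gamma_add_one (by norm_num), Real.Gamma_one_half_eq, one_div_mul_eq_div]
  have hpow : (3 * s / 2) ^ (3 / 2 : ℝ) = 3 * s / 2 * √(3 * s / 2) := by
    rw [Real.sqrt_eq_rpow, ← Real.rpow_one_add' (by positivity) (by norm_num)]
    norm_num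
  have hsqrt : √(2 / 3 * π * s) = 2 / 3 * √π * √(3 * s / 2) := by
    rw [← Real.sqrt_sq (show (0 : ℝ) ≤ 2 / 3 by norm_num), ← Real.sqrt_mul (by positivity),
      ← Real.sqrt_mul (by positivity)]
    ring_nf
  have hbase : π * s / (3 * Complex.I) = ((2 / 3 * π * s : ℝ) : ℂ) * (1 / (2 * Complex.I)) := by
    push_cast
    field_simp
  have hs' : (s : ℂ) ≠ 0 := mod_cast hs.ne'
  rw [hbase, ofReal_mul_cpow_half (by positivity), hsqrt, hGamma, hpow, stationaryCoeff]
  simp only [Complex.real_smul]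
  push_cast
  field_simp
  ring

theorem hasProfile_three_halves_of_hasMean (hs : s ≠ 0)
    (h : HasMean (fun j : ℕ => (𝐞 (4 / 27 * (s ^ 2)⁻¹ * (j : ℝ) ^ 3) : ℂ)) μ) :
    HasProfile (3 / 2) 2 s ((π * s / (3 * Complex.I)) ^ (1 / 2 : ℂ) * μ) := by
  wlog hpos : 0 < s generalizing s
  · have hneg : 0 < -s := by
      rw [neg_pos]
      exact lt_of_le_of_ne (not_lt.mp hpos) hs
    have hprofile := (this hneg.ne' (by simpa using h) hneg).neg
    have hbase (r : ℝ) : π * r / (3 * Complex.I) = ((-(π * r / 3) : ℝ) : ℂ) * Complex.I := by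
      push_cast
      field_simp
      rw [Complex.I_sq]
      ring
    rw [map_mul, hbase, conj_ofReal_mul_I_cpow_half, Complex.conj_ofReal] at hprofile
    simpa [hbase, neg_div] using hprofile
  have hsum := tendsto_sum_fourierChar_rpow_three_halves hpos h
  have hprofile := hasProfile_of_tendsto (b := 3 / 2) (d := 2) (by norm_num) (by norm_num)
    (by norm_num) hsum
  rw [← Gamma_smul_stationaryCoeff hpos]
  simpa only [Complex.real_smul, mul_assoc] using hprofile

theorem isBigO_powerDirichlet_three_halves {y : ℝ} (hy : y ≠ 0) :
    (fun x : ℝ => powerDirichlet (3 / 2) (x + Complex.I * y))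
      =O[𝓝[>] 0] fun x : ℝ => x ^ (-(1 / 2) : ℝ) := by
  have hs : y / (2 * π) ≠ 0 := by positivity
  obtain ⟨μ, hμ⟩ := exists_hasMean_ofReal_of_odd (4 / 27 * ((y / (2 * π)) ^ 2)⁻¹) (b := 3)
    (by decide)
  refine (hasProfile_three_halves_of_hasMean hs hμ).isBigO.congr_left fun x => ?_
  congr 2
  push_cast
  field_simp

theorem hasProfile_three_halves_sqrt_of_hasMean (hs : 0 < s)
    (h : HasMean (fun j : ℕ => (𝐞 (4 / 27 * s⁻¹ * (j : ℝ) ^ 3) : ℂ)) μ) :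
    HasProfile (3 / 2) 2 √s
      ((π / (3 * Complex.I)) ^ (1 / 2 : ℂ) * ((s ^ (1 / 4 : ℝ) : ℝ) : ℂ) * μ) := by
  have hroot : s ^ (1 / 4 : ℝ) = √√s := by
    rw [Real.sqrt_eq_rpow, Real.sqrt_eq_rpow, ← Real.rpow_mul hs.le]
    norm_num
  have hbase : π * √s / (3 * Complex.I) = √s * (π / (3 * Complex.I)) := by ring
  have hprofile := hasProfile_three_halves_of_hasMean (Real.sqrt_pos.mpr hs).ne'
    (by rwa [Real.sq_sqrt hs.le])
  rwa [hbase, ofReal_mul_cpow_half (Real.sqrt_pos.mpr hs), mul_comm (√√s : ℂ), ← hroot]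
    at hprofile

theorem hasProfile_three_halves_sqrt {m n : ℕ} (hm : 1 ≤ m) (hn : 1 ≤ n)
    (hs : s = 4 / 27 * (n / m)) :
    HasProfile (3 / 2) 2 √s
      ((π / (3 * Complex.I)) ^ (1 / 2 : ℂ) * ((s ^ (1 / 4 : ℝ) : ℝ) : ℂ) * expMean 3 m n) := by
  have hpos : 0 < s := hs ▸ by positivity
  have hdual : 4 / 27 * s⁻¹ = (m : ℝ) / n := by
    rw [hs]
    field_simp
  obtain ⟨μ, hμ⟩ := exists_hasMean_ofReal_of_odd (4 / 27 * s⁻¹) (b := 3) (by decide)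
  have hmean : expMean 3 m n = μ := by
    have hneg := hμ.fourierChar_neg
    rw [hdual, Complex.conj_ofReal] at hneg
    exact tendsto_nhds_unique (hasMean_expMean 3 m hn) hneg
  exact hmean ▸ hasProfile_three_halves_sqrt_of_hasMean hpos hμ

theorem ae_hasProfile_three_halves_sqrt_zero :
    ∀ᵐ s : ℝ, 0 < s → HasProfile (3 / 2) 2 √s 0 := by
  filter_upwards [ae_irrational] with s hirr hs
  have hdual : Irrational (4 / 27 * s⁻¹) := by
    simpa using hirr.inv.ratCast_mul (q := 4 / 27) (by norm_num)
  simpa using hasProfile_three_halves_sqrt_of_hasMean (μ := 0) hs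
    (by simpa using hasMean_fourierChar_mul_pow hdual (by norm_num : 1 ≤ 3))

theorem hasProfile_three_iff_hasProfile_three_halves (hs : s ≠ 0) (L : ℂ) :
    HasProfile 3 3 (4 / 27 * (s ^ 2)⁻¹) L ↔
      HasProfile (3 / 2) 2 s
        ((π * s / (3 * Complex.I)) ^ (1 / 2 : ℂ) / Real.Gamma (4 / 3) * L) := by
  obtain ⟨μ, hμ⟩ := exists_hasMean_ofReal_of_odd (4 / 27 * (s ^ 2)⁻¹) (b := 3) (by decide)
  have hthree := hasProfile_three_of_hasMean hμ
  have hthreeHalves := hasProfile_three_halves_of_hasMean hs hμ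
  have hGamma : (Real.Gamma (4 / 3) : ℂ) ≠ 0 := mod_cast (Real.Gamma_pos_of_pos (by norm_num)).ne'
  have hcoeff : (π * s / (3 * Complex.I)) ^ (1 / 2 : ℂ) ≠ 0 := by
    simp [Complex.cpow_eq_zero_iff, Real.pi_ne_zero, hs]
  have hcancel : (π * s / (3 * Complex.I)) ^ (1 / 2 : ℂ) / Real.Gamma (4 / 3)
      * (Real.Gamma (4 / 3) * μ) = (π * s / (3 * Complex.I)) ^ (1 / 2 : ℂ) * μ := by
    rw [← mul_assoc, div_mul_cancel₀ _ hGamma]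
  rw [← hcancel] at hthreeHalves
  refine ⟨fun h => h.unique hthree ▸ hthreeHalves, fun h => ?_⟩
  rwa [mul_left_cancel₀ (div_ne_zero hcoeff hGamma) (h.unique hthreeHalves)]

end ThreeHalves

theorem theorem5 :
    -- (i) the case `g(j) = j ^ b` with `b` a positive integer
    (∀ b : ℕ, 1 ≤ b →
      (∃ M : ℝ, ∀ᶠ x : ℝ in 𝓝[>] 0, ∀ y : ℝ,
        x ^ (1 / (b : ℝ)) * ‖powerDirichlet b ((x : ℂ) + Complex.I * (y : ℂ))‖ < M) ∧
      (∀ m n : ℕ, 1 ≤ n → Nat.Coprime m n →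
        HasProfile b b ((m : ℝ) / (n : ℝ))
          ((Real.Gamma (1 + 1 / (b : ℝ)) : ℂ) * expMean b m n)) ∧
      (∀ᵐ s : ℝ, HasProfile b b s 0)) ∧
    -- (ii) the case `g(j) = j ^ (3 / 2)`: growth at `0` and elsewhere on the imaginary line
    Tendsto (fun x : ℝ => ((x ^ (2 / 3 : ℝ) : ℝ) : ℂ) * powerDirichlet (3 / 2) (x : ℂ))
      (𝓝[>] 0) (𝓝 (Real.Gamma (5 / 3) : ℂ)) ∧
    (∀ y : ℝ, y ≠ 0 →
      (fun x : ℝ => powerDirichlet (3 / 2) ((x : ℂ) + Complex.I * (y : ℂ)))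
        =O[𝓝[>] (0 : ℝ)] (fun x : ℝ => x ^ (-(1 / 2) : ℝ))) ∧
    -- the profile of `g(j) = j ^ (3 / 2)`
    (∀ m n : ℕ, 1 ≤ m → 1 ≤ n → Nat.Coprime m n → ∀ s : ℝ,
      s = 4 / 27 * ((n : ℝ) / (m : ℝ)) →
        HasProfile (3 / 2) 2 (Real.sqrt s)
          (((Real.pi : ℂ) / (3 * Complex.I)) ^ (1 / 2 : ℂ) * ((s ^ (1 / 4 : ℝ) : ℝ) : ℂ) *
            expMean 3 m n)) ∧
    (∀ᵐ s : ℝ, 0 < s → HasProfile (3 / 2) 2 (Real.sqrt s) 0) ∧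
    -- the duality relation: if one of the two limits exists, so does the other
    (∀ s : ℝ, s ≠ 0 → ∀ L : ℂ,
      HasProfile 3 3 (4 / 27 * (s ^ 2)⁻¹) L ↔
        HasProfile (3 / 2) 2 s
          (((Real.pi : ℂ) * (s : ℂ) / (3 * Complex.I)) ^ (1 / 2 : ℂ) /
            (Real.Gamma (4 / 3) : ℂ) * L)) := by
  refine ⟨fun b hb => ⟨exists_forall_rpow_mul_norm_powerDirichlet_lt (mod_cast hb),
    fun m n hn _ => hasProfile_natCast_div hb m hn, ae_hasProfile_zero hb⟩, ?_,
    fun y => isBigO_powerDirichlet_three_halves,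
    fun m n hm hn _ s => hasProfile_three_halves_sqrt hm hn,
    ae_hasProfile_three_halves_sqrt_zero,
    fun s => hasProfile_three_iff_hasProfile_three_halves⟩
  have hzero := tendsto_rpow_mul_powerDirichlet (b := 3 / 2) (by norm_num)
  norm_num at hzero ⊢
  exact hzero
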